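/- **Notation.** For a set-valued operator $A:H\to 2^H$ on a real Hilbert space $H$: $A^{-1}u=\{x: u\in Ax\}$, $J_A=(\mathrm{Id}+A)^{-1}$, $A\,\square\,B=(A^{-1}+B^{-1})^{-1}$; $A$ is demiregular at $y$ with $Ay\neq\varnothing$ if, for all sequences with $v_n\in Ay_n$ and every $v\in Ay$, $y_n\rightharpoonup y$ and $v_n\to v$ imply $y_n\to y$. A bounded operator $U$ is strongly positive if $\langle Ux,x\rangle\ge\chi\|x\|^2$ for all $x$ and some $\chi>0$, and $\|x\|_U^2=\langle Ux,x\rangle$. **Setting.** Let $m,s\geq 1$ be integers, $\nu_0,\mu_0>0$, and let $K_1,\dots,K_m$, $G_1,\dots,G_s$ be real separable Hilbert spaces; $K=\bigoplus_i K_i$ and $G=\bigoplus_k G_k$ are the Hilbert direct sums. For every $i$ let $z_i\in K_i$, let $V_i$ be a bounded, self-adjoint, strongly positive operator on $K_i$, and let $C_i:K\to K_i$ satisfy, for all $x,y\in K$, $$\sum_i\langle x_i-y_i, C_ix-C_iy\rangle\ge\nu_0\sum_i\|C_ix-C_iy\|_{V_i}^2 .$$ For every $k$ let $r_k\in G_k$,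 let $W_k$ be a bounded, self-adjoint, strongly positive operator on $G_k$, let $B_k,D_k:G_k\to2^{G_k}$ be maximally monotone, with $D_k^{-1}$ single-valued and defined on all of $G_k$, and suppose that for all $v,w\in G$ $$\sum_k\langle v_k-w_k, D_k^{-1}v_k-D_k^{-1}w_k\rangle\ge\mu_0\sum_k\|D_k^{-1}v_k-D_k^{-1}w_k\|_{W_k}^2 .$$ Let $L_{k,i}:K_i\to G_k$ be bounded linear operators. Let $\mathcal P$ be the set of $x\in K$ for which there is $v\in G$ with $v_k\in(D_k\,\square\,B_k)\big(\sum_iL_{k,i}x_i-r_k\big)$ for all $k$ and $z_i=\sum_kL_{k,i}^*v_k+C_ix$ for all $i$. Let $\mathcal D$ be the set of $v\in G$ for which there is $x\in K$ with $z_i-\sum_kL_{k,i}^*v_k=C_ix$ for all $i$ and $\sum_iL_{k,i}x_i-r_k\in B_k^{-1}v_k+D_k^{-1}v_k$ for all $k$. Assume $\mathcal P\ne\varnothing$. Put $L:K\to G$, $x\mapsto(\sum_iL_{k,i}x_i)_k$, $V:x\mapsto(V_ix_i)_i$, $W:v\mapsto(W_kv_k)_k$, and $$\beta=\min\{\nu_0,\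 \mu_0(1-\|\sqrt W L\sqrt V\|^2)\}.$$ **Theorem.** Assume $2\beta>1$. Let $\varepsilon\in\,]0,\min\{1,\beta\}[$, $\lambda_n\in[\varepsilon,1]$, $\alpha_n\in[0,1-\varepsilon]$ for $n\in\mathbb N$. On a probability space let $(a_{i,n})_n$ and $(b_{k,n})_n$ be square integrable random processes with values in $K_i$ and $G_k$, let $x_{i,0}$, $v_{k,0}$ be square integrable random vectors in $K_i$, $G_k$, and set $x_{i,-1}=x_{i,0}$, $v_{k,-1}=v_{k,0}$. For every $n\in\mathbb N$, $i$ and $k$ iterate $$\begin{aligned} c_{i,n}&=x_{i,n}+\alpha_n(x_{i,n}-x_{i,n-1}), & d_{k,n}&=v_{k,n}+\alpha_n(v_{k,n}-v_{k,n-1}),\\ s_{i,n}&=c_{i,n}-V_i(a_{i,n}-z_i), & y_{i,n}&=s_{i,n}-V_i\textstyle\sum_kL_{k,i}^*d_{k,n},\\ q_{k,n}&=J_{W_kB_k^{-1}}\Big(d_{k,n}+W_k\big(\textstyle\sum_iL_{k,i}y_{i,n}-b_{k,n}-r_k\big)\Big), & v_{k,n+1}&=v_{k,n}+\lambda_n(q_{k,n}-v_{k,n}),\\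 p_{i,n}&=s_{i,n}-V_i\textstyle\sum_kL_{k,i}^*q_{k,n}, & x_{i,n+1}&=x_{i,n}+\lambda_n(p_{i,n}-x_{i,n}). \end{aligned}$$ Write $x_n=(x_{i,n})_i$, $v_n=(v_{k,n})_k$, $c_n=(c_{i,n})_i$, and $\mathcal F_n=\sigma\big((x_0,v_0),\dots,(x_n,v_n)\big)$. Suppose that 1. for every $n$, a.s., $\mathsf E[a_{i,n}\mid\mathcal F_n]=C_ic_n$ for all $i$ and $\mathsf E[b_{k,n}\mid\mathcal F_n]=D_k^{-1}d_{k,n}$ for all $k$; 2. $\sum_n\mathsf E\big[\sum_i\|a_{i,n}-C_ic_n\|^2+\sum_k\|b_{k,n}-D_k^{-1}d_{k,n}\|^2\,\big|\,\mathcal F_n\big]<+\infty$ a.s.; 3. $\sup_n\|x_{i,n}-x_{i,n-1}\|<\infty$ a.s. for every $i$, $\sup_n\|v_{k,n}-v_{k,n-1}\|<\infty$ a.s. for every $k$, and $\sum_n\alpha_n<+\infty$. Then there is a random vector $(\bar x,\bar v)$ in $K\times G$, $\mathcal P\times\mathcal D$-valued a.s., such that * (i) a.s., $x_{i,n}\rightharpoonup\bar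 x_i$ for every $i$ and $v_{k,n}\rightharpoonup\bar v_k$ for every $k$; * (ii) almost surely, if $x\mapsto(C_ix)_{1\le i\le m}$ is demiregular at $\bar x$, then $x_{i,n}\to\bar x_i$ for every $i$; * (iii) for every $j\in\{1,\dots,s\}$, almost surely, if $D_j^{-1}$ is demiregular at $\bar v_j$, then $v_{j,n}\to\bar v_j$; * (iv) for every $j\in\{1,\dots,m\}$ and every operator $C:K_j\to K_j$ with $C_jx=Cx_j$ for all $x\in K$, almost surely, if $C$ is demiregular at $\bar x_j$, then $x_{j,n}\to\bar x_j$. -/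

import Mathlib

open MeasureTheory Filter Topology
open scoped Pointwise InnerProductSpace

section Operators

variable {H : Type*} [NormedAddCommGroup H] [InnerProductSpace ℝ H]

/-- `U` is strongly positive: `⟪U x, x⟫ ≥ χ ‖x‖²` for some `χ > 0` and all `x`. -/
def StronglyPositive (U : H →L[ℝ] H) : Prop :=
  ∃ χ : ℝ, 0 < χ ∧ ∀ x : H, χ * ‖x‖ ^ 2 ≤ ⟪U x, x⟫_ℝ

/-- A set-valued operator `A : H → 2^H` is monotone. -/
def MonotoneOp (A : H → Set H) : Prop :=
  ∀ x y u v : H, u ∈ A x → v ∈ A y → 0 ≤ ⟪x - y, u - v⟫_ℝ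

/-- A set-valued operator is maximally monotone: it is monotone, and no monotone operator has a
strictly larger graph. -/
def MaximallyMonotone (A : H → Set H) : Prop :=
  MonotoneOp A ∧ ∀ A' : H → Set H, MonotoneOp A' → (∀ x, A x ⊆ A' x) → A' = A

/-- The inverse `A⁻¹ : u ↦ {x | u ∈ A x}` of a set-valued operator. -/
def inverseOp (A : H → Set H) : H → Set H := fun u => {x | u ∈ A x}

/-- The parallel sum `A □ B = (A⁻¹ + B⁻¹)⁻¹` (with the Minkowski sum of sets). -/
def parallelSum (A B : H → Set H) : H → Set H :=
  inverseOp fun u => inverseOp A u + inverseOp B u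

/-- The composition `U A : x ↦ {U u | u ∈ A x}` of a linear operator and a set-valued operator. -/
def compOp (U : H →L[ℝ] H) (A : H → Set H) : H → Set H := fun x => U '' A x

/-- The resolvent `J_A = (Id + A)⁻¹`, as a set-valued operator. -/
def resolventOp (A : H → Set H) : H → Set H := inverseOp fun x => {x} + A x

/-- Weak convergence of a sequence, i.e. convergence in the weak topology of `H`. -/
def WeaklyTendsto (u : ℕ → H) (l : H) : Prop :=
  Tendsto (fun n => toWeakSpace ℝ H (u n)) atTop (𝓝 (toWeakSpace ℝ H l))

/-- The set-valued operator `A` is demiregular at the point `y` of its domain: for every sequence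
`(y_n, v_n)` in the graph of `A` and every `v ∈ A y`, if `y_n ⇀ y` and `v_n → v`,
then `y_n → y`. -/
def DemiregularAt (A : H → Set H) (y : H) : Prop :=
  (A y).Nonempty ∧
    ∀ (yn vn : ℕ → H) (v : H), (∀ n, vn n ∈ A (yn n)) → v ∈ A y →
      WeaklyTendsto yn y → Tendsto vn atTop (𝓝 v) → Tendsto yn atTop (𝓝 y)

/-- A single-valued, everywhere defined operator, seen as a set-valued one. -/
def singleValued (F : H → H) : H → Set H := fun x => {F x}

/-- The positive square root of an operator is the positive operator `S` with `S ∘ S = T`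
(it is unique whenever it exists; the value `0` is used when there is none). -/
noncomputable def opSqrt [CompleteSpace H] (T : H →L[ℝ] H) : H →L[ℝ] H :=
  open Classical in
  if h : ∃ S : H →L[ℝ] H, S.IsPositive ∧ S * S = T then h.choose else 0

/-- Rescaling a strongly positive operator into a contraction of the identity. -/
theorem exists_norm_one_sub_smul_le {T : H →L[ℝ] H} (hp : StronglyPositive T) :
    ∃ t r : ℝ, 0 < t ∧ 0 ≤ r ∧ r < 1 ∧ ‖1 - t • T‖ ≤ r := by
  obtain ⟨χ, hχ, hTχ⟩ := hp
  obtain ⟨M, hM0, hTM, hχM⟩ : ∃ M : ℝ, 0 < M ∧ ‖T‖ ≤ M ∧ χ ≤ M :=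
    ⟨‖T‖ + χ, by positivity, by linarith, by linarith [norm_nonneg T]⟩
  have hq0 : 0 < χ ^ 2 / M ^ 2 := by positivity
  have hq1 : χ ^ 2 / M ^ 2 ≤ 1 := by
    rw [div_le_one (by positivity)]
    exact pow_le_pow_left₀ hχ.le hχM 2
  have ht0 : 0 < χ / M ^ 2 := by positivity
  refine ⟨χ / M ^ 2, √(1 - χ ^ 2 / M ^ 2), ht0, Real.sqrt_nonneg _, ?_, ?_⟩
  · rw [Real.sqrt_lt' one_pos]
    linarith
  · refine ContinuousLinearMap.opNorm_le_bound _ (Real.sqrt_nonneg _) fun x => ?_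
    refine (sq_le_sq₀ (norm_nonneg _) (by positivity)).1 ?_
    rw [mul_pow, Real.sq_sqrt (by linarith)]
    have e : (1 - (χ / M ^ 2) • T) x = x - (χ / M ^ 2) • T x := by simp
    rw [e, norm_sub_sq_real, inner_smul_right, norm_smul, real_inner_comm, Real.norm_eq_abs,
      abs_of_pos ht0, mul_pow]
    have h3 : ‖T x‖ ^ 2 ≤ M ^ 2 * ‖x‖ ^ 2 := by
      rw [← mul_pow]
      exact pow_le_pow_left₀ (norm_nonneg _) (T.le_of_opNorm_le hTM x) 2
    have h6 : (χ / M ^ 2) ^ 2 * ‖T x‖ ^ 2 ≤ (χ / M ^ 2) ^ 2 * (M ^ 2 * ‖x‖ ^ 2) :=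
      mul_le_mul_of_nonneg_left h3 (by positivity)
    have h5 : (χ / M ^ 2) ^ 2 * (M ^ 2 * ‖x‖ ^ 2) = χ ^ 2 / M ^ 2 * ‖x‖ ^ 2 := by field_simp
    have h7 : χ / M ^ 2 * (χ * ‖x‖ ^ 2) ≤ χ / M ^ 2 * ⟪T x, x⟫_ℝ :=
      mul_le_mul_of_nonneg_left (hTχ x) ht0.le
    have h8 : χ / M ^ 2 * (χ * ‖x‖ ^ 2) = χ ^ 2 / M ^ 2 * ‖x‖ ^ 2 := by ring
    linarith

/-- The equation `(1 - Y)² = 1 - X` has a self-adjoint solution when `X` is a self-adjoint strict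
contraction. -/
theorem exists_selfAdjoint_eq [CompleteSpace H] {X : H →L[ℝ] H} (hXsa : IsSelfAdjoint X) {r : ℝ}
    (hr0 : 0 ≤ r) (hr1 : r < 1) (hXr : ‖X‖ ≤ r) :
    ∃ Y : H →L[ℝ] H, IsSelfAdjoint Y ∧ ‖Y‖ ≤ r ∧ X + Y * Y = Y + Y := by
  lift r to NNReal using hr0
  let S : Set (H →L[ℝ] H) := {Y | IsSelfAdjoint Y ∧ ‖Y‖ ≤ r}
  have hSc : IsClosed S :=
    IsClosed.inter (isClosed_eq continuous_star continuous_id)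
      (isClosed_le continuous_norm continuous_const)
  have hSn : (0 : H →L[ℝ] H) ∈ S := ⟨IsSelfAdjoint.zero _, by simp⟩
  let f : (H →L[ℝ] H) → (H →L[ℝ] H) := fun Y => (2⁻¹ : ℝ) • (X + Y * Y)
  have hfS : Set.MapsTo f S S := by
    rintro Y ⟨h1, h2⟩
    refine ⟨IsSelfAdjoint.smul (IsSelfAdjoint.all _) (hXsa.add ?_), ?_⟩
    · rw [IsSelfAdjoint, star_mul, h1.star_eq]
    · have h3 : ‖Y * Y‖ ≤ r * r :=
        (norm_mul_le _ _).trans (mul_le_mul h2 h2 (norm_nonneg _) r.2)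
      have h4 : (r : ℝ) * r ≤ r := mul_le_of_le_one_right r.2 hr1.le
      have h5 := norm_add_le X (Y * Y)
      have h6 : ‖f Y‖ = 2⁻¹ * ‖X + Y * Y‖ := by
        simp only [f]
        rw [norm_smul]
        norm_num
      rw [h6]
      linarith
  have hlip : LipschitzWith r (hfS.restrict f S S) := by
    refine LipschitzWith.of_dist_le_mul ?_
    rintro ⟨Y, hY1, hY2⟩ ⟨Z, hZ1, hZ2⟩
    change dist (f Y) (f Z) ≤ r * dist Y Z
    rw [dist_eq_norm, dist_eq_norm]
    have e : f Y - f Z = (2⁻¹ : ℝ) • (Y * (Y - Z) + (Y - Z) * Z) := by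
      simp only [f]
      rw [← smul_sub]
      congr 1
      rw [mul_sub, sub_mul]
      abel
    have h1 : ‖Y * (Y - Z)‖ ≤ r * ‖Y - Z‖ :=
      (norm_mul_le _ _).trans (mul_le_mul_of_nonneg_right hY2 (norm_nonneg _))
    have h2 : ‖(Y - Z) * Z‖ ≤ ‖Y - Z‖ * r :=
      (norm_mul_le _ _).trans (mul_le_mul_of_nonneg_left hZ2 (norm_nonneg _))
    have h3 := norm_add_le (Y * (Y - Z)) ((Y - Z) * Z)
    have h4 : ‖f Y - f Z‖ = 2⁻¹ * ‖Y * (Y - Z) + (Y - Z) * Z‖ := by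
      rw [e, norm_smul]
      norm_num
    rw [h4]
    linarith
  have hcontr : ContractingWith r (hfS.restrict f S S) := ⟨by exact_mod_cast hr1, hlip⟩
  have : CompleteSpace S := hSc.completeSpace_coe
  obtain ⟨Y, hfix, -⟩ := hcontr.exists_fixedPoint ⟨0, hSn⟩ (edist_ne_top _ _)
  refine ⟨Y.1, Y.2.1, Y.2.2, ?_⟩
  have h : (2⁻¹ : ℝ) • (X + Y.1 * Y.1) = Y.1 := congrArg Subtype.val hfix
  calc X + Y.1 * Y.1 = (2 : ℝ) • ((2⁻¹ : ℝ) • (X + Y.1 * Y.1)) := by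
        rw [smul_smul]; norm_num
    _ = Y.1 + Y.1 := by rw [h, two_smul]

/-- A self-adjoint strongly positive operator has a positive square root, so that `opSqrt` has its
proper value there. -/
theorem exists_isPositive_mul_self [CompleteSpace H] {T : H →L[ℝ] H} (hT : IsSelfAdjoint T)
    (hp : StronglyPositive T) : ∃ S : H →L[ℝ] H, S.IsPositive ∧ S * S = T := by
  obtain ⟨t, r, ht0, hr0, hr1, hXr⟩ := exists_norm_one_sub_smul_le hp
  obtain ⟨Y, hY1, hY2, hYsq⟩ := exists_selfAdjoint_eq
    ((IsSelfAdjoint.one _).sub (IsSelfAdjoint.smul (IsSelfAdjoint.all t) hT)) hr0 hr1 hXr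
  have hsq : (1 - Y) * (1 - Y) = t • T := by
    have e : (1 - Y) * (1 - Y) = 1 - (Y + Y) + Y * Y := by
      noncomm_ring
    rw [e, ← hYsq]
    abel
  refine ⟨(√t)⁻¹ • (1 - Y), ?_, ?_⟩
  · rw [ContinuousLinearMap.isPositive_iff]
    refine ⟨(IsSelfAdjoint.smul (IsSelfAdjoint.all _)
      ((IsSelfAdjoint.one _).sub hY1)).isSymmetric, fun x => ?_⟩
    have h1 : ⟪Y x, x⟫_ℝ ≤ 1 * ‖x‖ ^ 2 := by
      refine (real_inner_le_norm _ _).trans ?_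
      have h2 := Y.le_of_opNorm_le (hY2.trans hr1.le) x
      rw [sq, ← mul_assoc]
      exact mul_le_mul_of_nonneg_right h2 (norm_nonneg x)
    have e : ⟪((√t)⁻¹ • (1 - Y)) x, x⟫_ℝ = (√t)⁻¹ * (‖x‖ ^ 2 - ⟪Y x, x⟫_ℝ) := by
      simp [inner_smul_left, inner_sub_left]
    rw [e]
    exact mul_nonneg (by positivity) (by linarith)
  · rw [smul_mul_smul_comm, hsq, smul_smul, ← mul_inv, Real.mul_self_sqrt ht0.le,
      inv_mul_cancel₀ ht0.ne', one_smul]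

end Operators

section ProductSpaces

variable {m s : ℕ}
  {K : Fin m → Type*} [∀ i, NormedAddCommGroup (K i)] [∀ i, InnerProductSpace ℝ (K i)]
  {G : Fin s → Type*} [∀ k, NormedAddCommGroup (G k)] [∀ k, InnerProductSpace ℝ (G k)]

/-- The operator `(x_i)_i ↦ (V_i x_i)_i` on the Hilbert direct sum. -/
noncomputable def diagOp (V : ∀ i, K i →L[ℝ] K i) : PiLp 2 K →L[ℝ] PiLp 2 K :=
  (PiLp.continuousLinearEquiv 2 ℝ K).symm.toContinuousLinearMap ∘L
    ContinuousLinearMap.pi fun i => V i ∘L PiLp.proj 2 K i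

/-- The operator `(x_i)_i ↦ (∑ i, L_{k,i} x_i)_k` between the Hilbert direct sums. -/
noncomputable def blockOp (L : ∀ k i, K i →L[ℝ] G k) : PiLp 2 K →L[ℝ] PiLp 2 G :=
  (PiLp.continuousLinearEquiv 2 ℝ G).symm.toContinuousLinearMap ∘L
    ContinuousLinearMap.pi fun k => ∑ i, L k i ∘L PiLp.proj 2 K i

@[simp] theorem diagOp_apply (V : ∀ i, K i →L[ℝ] K i) (x : PiLp 2 K) (i : Fin m) :
    diagOp V x i = V i (x i) := rfl

@[simp] theorem blockOp_apply (L : ∀ k i, K i →L[ℝ] G k) (x : PiLp 2 K) (k : Fin s) :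
    blockOp L x k = ∑ i, L k i (x i) := by
  simp [blockOp]

variable [∀ i, CompleteSpace (K i)] [∀ k, CompleteSpace (G k)]

/-- The constant `min {ν₀, μ₀ (1 - ‖√W L √V‖²)}`. -/
noncomputable def betaConst (ν₀ μ₀ : ℝ) (V : ∀ i, K i →L[ℝ] K i) (W : ∀ k, G k →L[ℝ] G k)
    (L : ∀ k i, K i →L[ℝ] G k) : ℝ :=
  min ν₀ (μ₀ * (1 - ‖opSqrt (diagOp W) ∘L blockOp L ∘L opSqrt (diagOp V)‖ ^ 2))

/-- The solutions `x` of the primal inclusion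
`z ∈ A x + L^* ((D □ B) (L x - r)) + C x` in the direct sum of the `K i`, where
`A x = ∏ A_i x_i` and `(D □ B) w = ∏ (D_k □ B_k) w_k`. Thus one selection
`v_k ∈ (D_k □ B_k) (∑ i, L_{k,i} x_i - r_k)` serves all the coordinates `i`. -/
def primalSolutions (z : ∀ i, K i) (A : ∀ i, K i → Set (K i)) (C : PiLp 2 K → PiLp 2 K)
    (r : ∀ k, G k) (B D : ∀ k, G k → Set (G k)) (L : ∀ k i, K i →L[ℝ] G k) : Set (PiLp 2 K) :=
  {x | ∃ v : PiLp 2 G, (∀ k, v k ∈ parallelSum (D k) (B k) ((∑ i, L k i (x i)) - r k)) ∧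
    ∀ i, z i ∈ A i (x i) + {∑ k, (L k i).adjoint (v k)} + {C x i}}

/-- The solutions `v` of the dual inclusion: there is `x` such that
`z_i - ∑ k, L_{k,i}^* v_k ∈ A_i x_i + C_i x` for all `i` and
`∑ i, L_{k,i} x_i - r_k ∈ B_k⁻¹ v_k + D_k⁻¹ v_k` for all `k`. -/
def dualSolutions (z : ∀ i, K i) (A : ∀ i, K i → Set (K i)) (C : PiLp 2 K → PiLp 2 K)
    (r : ∀ k, G k) (B D : ∀ k, G k → Set (G k)) (L : ∀ k i, K i →L[ℝ] G k) : Set (PiLp 2 G) :=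
  {v | ∃ x : PiLp 2 K,
    (∀ i, z i - ∑ k, (L k i).adjoint (v k) ∈ A i (x i) + {C x i}) ∧
    ∀ k, (∑ i, L k i (x i)) - r k ∈ inverseOp (B k) (v k) + inverseOp (D k) (v k)}

end ProductSpaces

/-- The σ-algebra `σ((x₀, v₀), …, (x_n, v_n))` generated by the first `n + 1` terms of the process
`(x_n, v_n)`. -/
abbrev historySigma {Ω E F : Type*} [MeasurableSpace E] [MeasurableSpace F]
    (x : ℕ → Ω → E) (v : ℕ → Ω → F) (n : ℕ) : MeasurableSpace Ω :=
  ⨆ j ∈ Set.Iic n, MeasurableSpace.comap (fun ω => (x j ω, v j ω)) inferInstance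

/-! In the product space of pairs (x, v), the primal and dual inclusions together say 0 ∈ M t + Q t,
where M(x, v) = (L^* v - z, r + B⁻¹ v - L x) is monotone and Q(x, v) = (C x, D⁻¹ v) is
single-valued. In the metric U = V⁻¹ ⊕ (W⁻¹ - L V L^*) one pass of the algorithm is a relaxed,
inertial forward-backward step for M + Q with a noisy value of Q (`backward_mem`). The number 1 -
‖√W L √V‖², positive because β is, bounds the Schur complement from below, so U is strongly
positive, and it also makes Q β-cocoercive for the norm of U⁻¹ (`schur_bounds`,
`primalDual_cocoercive`).

For each zero z of M + Q, monotonicity, cocoercivity and 2β > 1 give a one-step estimate for the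
U-distance to z (`inner_step_le`). Its errors are an inertial term, summable because the increments
are bounded and Σ α_n < ∞, a squared noise term, and a cross term that unbiasedness removes on
integration over past events. `robbins_siegmund` then yields convergence of the distances and
summable residuals, whence Q(c_n) → Q z and c_n - t_n → 0, with c_n the extrapolated point and t_n
the backward point.

Weak cluster points are zeros, because the graph of M is weakly-strongly closed
(`mem_primalDualOp_of_tendsto`) and cocoercivity identifies the limit of Q(c_n). Opial's lemma over
a countable dense set of zeros gives almost sure weak convergence. The forward terms C(c_n) and
D⁻¹(d_n) converge strongly, which is exactly what demiregularity needs to upgrade weak convergence.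
-/

/-! ### Almost supermartingales and the Robbins–Siegmund theorem. -/

section AlmostSupermartingale

variable {Ω : Type*} {m0 : MeasurableSpace Ω} {P : Measure Ω} {F : Filtration ℕ m0}
  {ξ θ η : ℕ → Ω → ℝ} {N : ℝ}

/-- The event that the first `n` increments `η` have total absolute size at most `N`. -/
def budgetSet (η : ℕ → Ω → ℝ) (N : ℝ) (n : ℕ) : Set Ω :=
  {ω | ∑ k ∈ Finset.range n, |η k ω| ≤ N}

theorem budgetSet_succ_subset (η : ℕ → Ω → ℝ) (N : ℝ) (n : ℕ) :
    budgetSet η N (n + 1) ⊆ budgetSet η N n := by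
  intro ω hω
  simp only [budgetSet, Set.mem_ofPred_eq, Finset.sum_range_succ] at hω ⊢
  linarith [abs_nonneg (η n ω)]

theorem budgetSet_zero (hN : 0 ≤ N) : budgetSet η N 0 = Set.univ := by
  ext ω
  simp [budgetSet, hN]

/-- Only η_0, …, η_n enter at index n + 1, so this event is already known at time n; it can
therefore serve as a test event in the conditional inequality of step n. -/
theorem measurableSet_budgetSet (hη : StronglyAdapted F η) (N : ℝ) (n : ℕ) :
    MeasurableSet[F n] (budgetSet η N (n + 1)) := by
  have h : Measurable[F n] fun ω => ∑ k ∈ Finset.range (n + 1), |η k ω| := by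
    refine Finset.measurable_fun_sum _ fun k hk => ?_
    have hkn : k ≤ n := Nat.lt_succ_iff.1 (Finset.mem_range.1 hk)
    exact continuous_abs.measurable.comp (((hη k).mono (F.mono hkn)).measurable)
  exact h measurableSet_Iic

theorem measurableSet_budgetSet' (hη : StronglyAdapted F η) (hN : 0 ≤ N) (n : ℕ) :
    MeasurableSet[F n] (budgetSet η N n) := by
  cases n with
  | zero => rw [budgetSet_zero hN]; exact MeasurableSet.univ
  | succ n => exact F.mono n.le_succ _ (measurableSet_budgetSet hη N n)

/-- Either the last budget is respected, and then it bounds the whole sum, or it is exceeded, and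
then the last term is zero. -/
theorem sum_indicator_budgetSet_le (hN : 0 ≤ N) (n : ℕ) (ω : Ω) :
    ∑ k ∈ Finset.range n, (budgetSet η N (k + 1)).indicator (fun ω => |η k ω|) ω ≤ N := by
  induction n with
  | zero => simpa using hN
  | succ n ih =>
    by_cases h : ω ∈ budgetSet η N (n + 1)
    · refine le_trans (Finset.sum_le_sum fun k _ => ?_) h
      exact Set.indicator_le_self' (fun _ _ => abs_nonneg _) _
    · rw [Finset.sum_range_succ, Set.indicator_of_notMem h, add_zero]
      exact ih

theorem sum_setIntegral_budgetSet_le [IsProbabilityMeasure P] (hη : StronglyAdapted F η)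
    (hηi : ∀ n, Integrable (η n) P) (hN : 0 ≤ N) (n : ℕ) :
    ∑ k ∈ Finset.range n, ∫ ω in budgetSet η N (k + 1), |η k ω| ∂P ≤ N := by
  have hm : ∀ k, MeasurableSet (budgetSet η N (k + 1)) := fun k =>
    F.le k _ (measurableSet_budgetSet hη N k)
  have e : ∑ k ∈ Finset.range n, ∫ ω in budgetSet η N (k + 1), |η k ω| ∂P =
      ∫ ω, ∑ k ∈ Finset.range n, (budgetSet η N (k + 1)).indicator (fun ω => |η k ω|) ω ∂P := by
    rw [integral_finsetSum _ fun k _ => (hηi k).abs.indicator (hm k)]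
    exact Finset.sum_congr rfl fun k _ => (integral_indicator (hm k)).symm
  rw [e]
  calc _ ≤ ∫ _, N ∂P := integral_mono
        (integrable_finsetSum _ fun k _ => (hηi k).abs.indicator (hm k)) (integrable_const _)
        fun ω => sum_indicator_budgetSet_le hN n ω
    _ = N := by simp

/-- The telescoped almost supermartingale inequality on the budget sets. -/
theorem setIntegral_budgetSet_add_sum_le [IsProbabilityMeasure P]
    (hξi : ∀ n, Integrable (ξ n) P) (hξ0 : ∀ n ω, 0 ≤ ξ n ω)
    (hθi : ∀ n, Integrable (θ n) P)
    (hη : StronglyAdapted F η) (hηi : ∀ n, Integrable (η n) P)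
    (hstep : ∀ n S, MeasurableSet[F n] S →
      ∫ ω in S, (ξ (n + 1) ω + θ n ω) ∂P ≤ ∫ ω in S, (ξ n ω + η n ω) ∂P)
    (hN : 0 ≤ N) (n : ℕ) :
    ∫ ω in budgetSet η N n, ξ n ω ∂P +
      ∑ k ∈ Finset.range n, ∫ ω in budgetSet η N (k + 1), θ k ω ∂P ≤ ∫ ω, ξ 0 ω ∂P + N := by
  suffices h : ∫ ω in budgetSet η N n, ξ n ω ∂P +
      ∑ k ∈ Finset.range n, ∫ ω in budgetSet η N (k + 1), θ k ω ∂P ≤ ∫ ω, ξ 0 ω ∂P +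
        ∑ k ∈ Finset.range n, ∫ ω in budgetSet η N (k + 1), |η k ω| ∂P by
    linarith [sum_setIntegral_budgetSet_le (P := P) hη hηi hN n]
  induction n with
  | zero => simp [budgetSet_zero hN]
  | succ n ih =>
    rw [Finset.sum_range_succ, Finset.sum_range_succ]
    have h1 := hstep n _ (measurableSet_budgetSet hη N n)
    rw [integral_add (hξi _).integrableOn (hθi _).integrableOn,
      integral_add (hξi _).integrableOn (hηi _).integrableOn] at h1
    -- Shrinking the event only loses mass, as ξ is nonnegative; this is what lets the sum
    -- telescope.
    have h2 : ∫ ω in budgetSet η N (n + 1), ξ n ω ∂P ≤ ∫ ω in budgetSet η N n, ξ n ω ∂P :=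
      setIntegral_mono_set (hξi n).integrableOn (ae_of_all _ (hξ0 n))
        (budgetSet_succ_subset η N n).eventuallyLE
    have h3 : ∫ ω in budgetSet η N (n + 1), η n ω ∂P ≤
        ∫ ω in budgetSet η N (n + 1), |η n ω| ∂P :=
      integral_mono (hηi n).integrableOn (hηi n).abs.integrableOn fun ω => le_abs_self _
    linarith

/-- Nonnegative functions whose integrals have bounded partial sums are almost everywhere
summable. -/
theorem ae_summable_of_sum_integral_le {f : ℕ → Ω → ℝ} (hf : ∀ n, Integrable (f n) P)
    (hf0 : ∀ n ω, 0 ≤ f n ω) {R : ℝ} (hR : ∀ n, ∑ k ∈ Finset.range n, ∫ ω, f k ω ∂P ≤ R) :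
    ∀ᵐ ω ∂P, Summable fun n => f n ω := by
  have h1 : ∫⁻ ω, ∑' n, ENNReal.ofReal (f n ω) ∂P ≤ ENNReal.ofReal R := by
    rw [lintegral_tsum fun n => (hf n).aemeasurable.ennreal_ofReal]
    refine ENNReal.tsum_le_of_sum_range_le fun n => ?_
    have e : ∀ k, ∫⁻ ω, ENNReal.ofReal (f k ω) ∂P = ENNReal.ofReal (∫ ω, f k ω ∂P) := fun k =>
      (ofReal_integral_eq_lintegral_ofReal (hf k) (ae_of_all _ (hf0 k))).symm
    simp_rw [e]
    rw [← ENNReal.ofReal_sum_of_nonneg fun k _ => integral_nonneg (hf0 k)]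
    exact ENNReal.ofReal_le_ofReal (hR n)
  have h2 := ae_lt_top' (AEMeasurable.tsum fun n => (hf n).aemeasurable.ennreal_ofReal)
    (h1.trans_lt ENNReal.ofReal_lt_top).ne
  filter_upwards [h2] with ω hω
  have := ENNReal.summable_toReal hω.ne
  simpa only [ENNReal.toReal_ofReal (hf0 _ ω)] using this

theorem exists_nat_forall_mem_budgetSet {ω : Ω} (h : Summable fun n => η n ω) :
    ∃ N : ℕ, ∀ n, ω ∈ budgetSet η N n := by
  obtain ⟨N, hN⟩ := exists_nat_ge (∑' n, |η n ω|)
  exact ⟨N, fun n => (h.abs.sum_le_tsum _ fun _ _ => abs_nonneg _).trans hN⟩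

/-- Localisation: for each integer N the terms θ cut off by the budget N have bounded total
integral, and almost every path stays within some N forever. No adaptedness of θ is needed. -/
theorem ae_summable_of_almostSupermartingale [IsProbabilityMeasure P]
    (hξi : ∀ n, Integrable (ξ n) P) (hξ0 : ∀ n ω, 0 ≤ ξ n ω)
    (hθi : ∀ n, Integrable (θ n) P) (hθ0 : ∀ n ω, 0 ≤ θ n ω)
    (hη : StronglyAdapted F η) (hηi : ∀ n, Integrable (η n) P)
    (hstep : ∀ n S, MeasurableSet[F n] S →
      ∫ ω in S, (ξ (n + 1) ω + θ n ω) ∂P ≤ ∫ ω in S, (ξ n ω + η n ω) ∂P)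
    (hsum : ∀ᵐ ω ∂P, Summable fun n => η n ω) :
    ∀ᵐ ω ∂P, Summable fun n => θ n ω := by
  have hm : ∀ (N : ℕ) k, MeasurableSet (budgetSet η N (k + 1)) := fun N k =>
    F.le k _ (measurableSet_budgetSet hη N k)
  have h : ∀ N : ℕ, ∀ᵐ ω ∂P,
      Summable fun n => (budgetSet η N (n + 1)).indicator (θ n) ω := by
    intro N
    refine ae_summable_of_sum_integral_le (R := ∫ ω, ξ 0 ω ∂P + N)
      (fun n => (hθi n).indicator (hm N n))
      (fun n ω => Set.indicator_nonneg (fun _ _ => hθ0 n _) _) fun n => ?_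
    simp_rw [integral_indicator (hm N _)]
    have h1 := setIntegral_budgetSet_add_sum_le hξi hξ0 hθi hη hηi hstep N.cast_nonneg n
    have h2 : 0 ≤ ∫ ω in budgetSet η N n, ξ n ω ∂P := integral_nonneg (hξ0 n)
    linarith
  filter_upwards [ae_all_iff.2 h, hsum] with ω hω hs
  obtain ⟨N, hN⟩ := exists_nat_forall_mem_budgetSet hs
  refine (hω N).congr fun n => ?_
  rw [Set.indicator_of_mem (hN _)]

/-- Killing ξ when the budget is exceeded and subtracting the accepted increments gives an
L¹-bounded supermartingale `Y N`, which converges almost surely. On a path that never exceeds N, it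
equals ξ minus a convergent series. -/
theorem ae_exists_tendsto_of_almostSupermartingale [IsProbabilityMeasure P]
    (hξ : StronglyAdapted F ξ) (hξi : ∀ n, Integrable (ξ n) P) (hξ0 : ∀ n ω, 0 ≤ ξ n ω)
    (hη : StronglyAdapted F η) (hηi : ∀ n, Integrable (η n) P)
    (hstep : ∀ n S, MeasurableSet[F n] S →
      ∫ ω in S, ξ (n + 1) ω ∂P ≤ ∫ ω in S, (ξ n ω + η n ω) ∂P)
    (hsum : ∀ᵐ ω ∂P, Summable fun n => η n ω) :
    ∀ᵐ ω ∂P, ∃ l, Tendsto (fun n => ξ n ω) atTop (𝓝 l) := by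
  have hm : ∀ (N : ℕ) k, MeasurableSet (budgetSet η N (k + 1)) := fun N k =>
    F.le k _ (measurableSet_budgetSet hη N k)
  have hm' : ∀ (N : ℕ) k, MeasurableSet (budgetSet η N k) := fun N k =>
    F.le k _ (measurableSet_budgetSet' hη N.cast_nonneg k)
  let Y : ℕ → ℕ → Ω → ℝ := fun N n ω => (budgetSet η N n).indicator (ξ n) ω -
    ∑ k ∈ Finset.range n, (budgetSet η N (k + 1)).indicator (η k) ω
  have hYi : ∀ N n, Integrable (Y N n) P := fun N n =>
    ((hξi n).indicator (hm' N n)).sub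
      (integrable_finsetSum _ fun k _ => (hηi k).indicator (hm N k))
  have hYm : ∀ N, StronglyAdapted F (Y N) := by
    intro N n
    refine ((hξ n).indicator (measurableSet_budgetSet' hη N.cast_nonneg n)).sub
      (Finset.stronglyMeasurable_fun_sum _ fun k hk => ?_)
    have hkn : k ≤ n := (Finset.mem_range.1 hk).le
    exact ((hη k).indicator (measurableSet_budgetSet hη N k)).mono (F.mono hkn)
  have hYs : ∀ N, Supermartingale (Y N) F P := by
    intro N
    refine supermartingale_of_setIntegral_succ_le (hYm N) (hYi N) fun n S hS => ?_
    have hS' := F.le n _ hS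
    have h1 : ∫ ω in S, (Y N (n + 1) ω - Y N n ω) ∂P ≤ 0 := by
      have e : ∀ ω, Y N (n + 1) ω - Y N n ω = (budgetSet η N (n + 1)).indicator (ξ (n + 1)) ω -
          (budgetSet η N n).indicator (ξ n) ω - (budgetSet η N (n + 1)).indicator (η n) ω := by
        intro ω
        simp only [Y, Finset.sum_range_succ]
        ring
      -- On exceeding the budget the killed process drops to 0, which is the right direction because
      -- ξ ≥ 0.
      have h2 : ∀ ω, Y N (n + 1) ω - Y N n ω ≤ (budgetSet η N (n + 1)).indicator
          (fun ω => ξ (n + 1) ω - (ξ n ω + η n ω)) ω := by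
        intro ω
        rw [e]
        by_cases h : ω ∈ budgetSet η N (n + 1)
        · simp only [Set.indicator_of_mem h, Set.indicator_of_mem (budgetSet_succ_subset _ _ _ h)]
          linarith
        · simp only [Set.indicator_of_notMem h]
          have : 0 ≤ (budgetSet η N n).indicator (ξ n) ω :=
            Set.indicator_nonneg (fun _ _ => hξ0 n _) _
          linarith
      have hi : Integrable (fun ω => ξ (n + 1) ω - (ξ n ω + η n ω)) P :=
        (hξi _).sub ((hξi _).add (hηi _))
      refine (integral_mono (((hYi N _).sub (hYi N _)).integrableOn)
        ((hi.indicator (hm N n)).integrableOn) h2).trans ?_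
      rw [setIntegral_indicator (hm N n),
        integral_sub (g := fun ω => ξ n ω + η n ω) (hξi _).integrableOn
          ((hξi _).add (hηi _)).integrableOn]
      have := hstep n _ (hS.inter (measurableSet_budgetSet hη N n))
      linarith
    rw [integral_sub (hYi N _).integrableOn (hYi N _).integrableOn] at h1
    linarith
  -- One N comes from the bound for the integral of the killed ξ, the other from the subtracted
  -- increments.
  have hYb : ∀ (N : ℕ) n, eLpNorm (-Y N n) 1 P ≤
      ((∫ ω, ξ 0 ω ∂P + N + N).toNNReal : NNReal) := by
    intro N n
    rw [eLpNorm_neg, eLpNorm_one_eq_lintegral_enorm, ← ofReal_integral_norm_eq_lintegral_enorm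
      (hYi N n)]
    refine ENNReal.ofReal_le_ofReal ?_
    have h1 := setIntegral_budgetSet_add_sum_le (θ := fun _ _ => 0) hξi hξ0
      (fun _ => integrable_zero _ _ _) hη hηi (by simpa using hstep) N.cast_nonneg n
    simp only [integral_zero, Finset.sum_const_zero, add_zero] at h1
    calc ∫ ω, ‖Y N n ω‖ ∂P ≤ ∫ ω, ((budgetSet η N n).indicator (ξ n) ω + N) ∂P := by
          refine integral_mono (hYi N n).norm
            (((hξi n).indicator (hm' N n)).add (integrable_const _)) fun ω => ?_
          refine (norm_sub_le _ _).trans (add_le_add ?_ ?_)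
          · rw [Real.norm_of_nonneg (Set.indicator_nonneg (fun _ _ => hξ0 n _) _)]
          · refine (norm_sum_le _ _).trans (le_trans (Finset.sum_le_sum fun k _ => ?_)
              (sum_indicator_budgetSet_le (η := η) N.cast_nonneg n ω))
            rw [norm_indicator_eq_indicator_norm]
            rfl
      _ ≤ _ := by
          rw [integral_add ((hξi n).indicator (hm' N n)) (integrable_const _),
            integral_indicator (hm' N n)]
          simp only [integral_const, probReal_univ, smul_eq_mul, one_mul]
          linarith
  have hconv : ∀ N, ∀ᵐ ω ∂P, ∃ l, Tendsto (fun n => (-Y N) n ω) atTop (𝓝 l) := fun N =>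
    (hYs N).neg.exists_ae_tendsto_of_bdd (hYb N)
  filter_upwards [ae_all_iff.2 hconv, hsum] with ω hω hs
  obtain ⟨N, hN⟩ := exists_nat_forall_mem_budgetSet hs
  obtain ⟨l, hl⟩ := hω N
  refine ⟨-l + ∑' n, η n ω, ?_⟩
  refine (hl.neg.add hs.hasSum.tendsto_sum_nat).congr fun n => ?_
  simp [Y, Set.indicator_of_mem (hN _)]

/-- **Robbins–Siegmund theorem** for nonnegative almost supermartingales, with the conditional
inequality stated by integration over the events of the filtration. -/
theorem robbins_siegmund [IsProbabilityMeasure P] {γ : ℕ → ℝ} (hγ0 : ∀ n, 0 ≤ γ n)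
    (hγ : Summable γ)
    (hξ : StronglyAdapted F ξ) (hξi : ∀ n, Integrable (ξ n) P) (hξ0 : ∀ n ω, 0 ≤ ξ n ω)
    (hθi : ∀ n, Integrable (θ n) P) (hθ0 : ∀ n ω, 0 ≤ θ n ω)
    (hη : StronglyAdapted F η) (hηi : ∀ n, Integrable (η n) P)
    (hstep : ∀ n S, MeasurableSet[F n] S →
      ∫ ω in S, (ξ (n + 1) ω + θ n ω) ∂P ≤ ∫ ω in S, ((1 + γ n) * ξ n ω + η n ω) ∂P)
    (hsum : ∀ᵐ ω ∂P, Summable fun n => η n ω) :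
    ∀ᵐ ω ∂P, (∃ l, Tendsto (fun n => ξ n ω) atTop (𝓝 l)) ∧ Summable fun n => θ n ω := by
  -- Discount weights: 1 + γ ≤ e^γ lets them absorb the growth factor, and Σ γ < ∞ keeps them away
  -- from 0, so they can be divided out at the end.
  let w : ℕ → ℝ := fun n => Real.exp (-∑ k ∈ Finset.range n, γ k)
  have hw0 : ∀ n, 0 < w n := fun n => Real.exp_pos _
  have hw1 : ∀ n, w n ≤ 1 := fun n => by
    rw [Real.exp_le_one_iff, neg_nonpos]
    exact Finset.sum_nonneg fun k _ => hγ0 k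
  have hwstep : ∀ n, w (n + 1) * (1 + γ n) ≤ w n := fun n => by
    have : w n = w (n + 1) * Real.exp (γ n) := by
      simp only [w, ← Real.exp_add, Finset.sum_range_succ]
      congr 1
      ring
    rw [this]
    exact mul_le_mul_of_nonneg_left (by linarith [Real.add_one_le_exp (γ n)]) (hw0 _).le
  have hwlim : Tendsto w atTop (𝓝 (Real.exp (-∑' k, γ k))) :=
    (Real.continuous_exp.tendsto _).comp hγ.hasSum.tendsto_sum_nat.neg
  have hwpos : 0 < Real.exp (-∑' k, γ k) := Real.exp_pos _
  have hwge : ∀ n, Real.exp (-∑' k, γ k) ≤ w n := fun n => by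
    refine Real.exp_le_exp.2 (neg_le_neg ?_)
    exact hγ.sum_le_tsum _ fun k _ => hγ0 k
  have hstep' : ∀ n S, MeasurableSet[F n] S →
      ∫ ω in S, (w (n + 1) * ξ (n + 1) ω + w (n + 1) * θ n ω) ∂P ≤
        ∫ ω in S, (w n * ξ n ω + w (n + 1) * η n ω) ∂P := by
    intro n S hS
    have h1 := mul_le_mul_of_nonneg_left (hstep n S hS) (hw0 (n + 1)).le
    rw [← integral_const_mul, ← integral_const_mul] at h1
    simp only [← mul_add]
    refine h1.trans (integral_mono ?_ ?_ fun ω => ?_)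
    · exact ((((hξi n).const_mul _).add (hηi n)).const_mul _).integrableOn
    · exact (((hξi n).const_mul _).add ((hηi n).const_mul _)).integrableOn
    · have := mul_le_mul_of_nonneg_right (hwstep n) (hξ0 n ω)
      simp only
      linarith
  have hwη : ∀ᵐ ω ∂P, Summable fun n => w (n + 1) * η n ω := by
    filter_upwards [hsum] with ω hω
    refine Summable.of_norm_bounded hω.norm fun n => ?_
    rw [norm_mul, Real.norm_of_nonneg (hw0 _).le]
    exact mul_le_of_le_one_left (norm_nonneg _) (hw1 _)
  have hη' : StronglyAdapted F fun n ω => w (n + 1) * η n ω := fun n => (hη n).const_mul _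
  have hηi' : ∀ n, Integrable (fun ω => w (n + 1) * η n ω) P := fun n => (hηi n).const_mul _
  have hξi' : ∀ n, Integrable (fun ω => w n * ξ n ω) P := fun n => (hξi n).const_mul _
  have hθi' : ∀ n, Integrable (fun ω => w (n + 1) * θ n ω) P := fun n => (hθi n).const_mul _
  have hξ0' : ∀ n ω, 0 ≤ w n * ξ n ω := fun n ω => mul_nonneg (hw0 n).le (hξ0 n ω)
  have hθ0' : ∀ n ω, 0 ≤ w (n + 1) * θ n ω := fun n ω => mul_nonneg (hw0 _).le (hθ0 n ω)
  have h1 := ae_summable_of_almostSupermartingale hξi' hξ0' hθi' hθ0' hη' hηi' hstep' hwη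
  have h2 := ae_exists_tendsto_of_almostSupermartingale (fun n => (hξ n).const_mul (w n)) hξi'
    hξ0' hη' hηi' (fun n S hS => (integral_mono (hξi' _).integrableOn
      ((hξi' _).add (hθi' _)).integrableOn
      fun ω => le_add_of_nonneg_right (hθ0' n ω)).trans (hstep' n S hS)) hwη
  filter_upwards [h1, h2] with ω h1 ⟨l, hl⟩
  refine ⟨⟨l / Real.exp (-∑' k, γ k), ?_⟩, ?_⟩
  · refine (hl.div hwlim hwpos.ne').congr fun n => ?_
    exact mul_div_cancel_left₀ _ (hw0 n).ne'
  · refine Summable.of_nonneg_of_le (hθ0 · ω) (fun n => ?_)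
      (h1.mul_left (Real.exp (-∑' k, γ k))⁻¹)
    rw [← mul_assoc]
    refine le_mul_of_one_le_left (hθ0 n ω) ?_
    rw [← div_eq_inv_mul, one_le_div hwpos]
    exact hwge _

/-- Conditional summability implies summability, for nonnegative integrable functions that need
not be adapted. -/
theorem ae_summable_of_summable_condExp [IsProbabilityMeasure P]
    (hθi : ∀ n, Integrable (θ n) P) (hθ0 : ∀ n ω, 0 ≤ θ n ω)
    (hsum : ∀ᵐ ω ∂P, Summable fun n => (P[θ n | F n]) ω) :
    ∀ᵐ ω ∂P, Summable fun n => θ n ω := by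
  refine ae_summable_of_almostSupermartingale (F := F) (ξ := fun _ _ => 0)
    (η := fun n => P[θ n | F n]) (fun _ => integrable_zero _ _ _) (fun _ _ => le_rfl) hθi hθ0
    (fun n => stronglyMeasurable_condExp) (fun n => integrable_condExp) (fun n S hS => ?_) hsum
  simp only [zero_add]
  rw [setIntegral_condExp (F.le n) (hθi n) hS]

end AlmostSupermartingale

/-! ### Weak convergence, Opial's lemma and measurability of weak limits. -/

section WeakConvergence

variable {H : Type*} [NormedAddCommGroup H] [InnerProductSpace ℝ H]

theorem weaklyTendsto_iff [CompleteSpace H] {u : ℕ → H} {l : H} :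
    WeaklyTendsto u l ↔ ∀ h : H, Tendsto (fun n => ⟪h, u n⟫_ℝ) atTop (𝓝 ⟪h, l⟫_ℝ) := by
  have hinj : Function.Injective (topDualPairing ℝ H).flip := fun x y hxy => by
    refine ext_inner_left ℝ fun h => ?_
    exact DFunLike.congr_fun hxy (InnerProductSpace.toDual ℝ H h)
  refine (WeakBilin.tendsto_iff_forall_eval_tendsto _ hinj).trans ?_
  constructor
  · intro H' h
    exact H' (InnerProductSpace.toDual ℝ H h)
  · intro H' y
    obtain ⟨h, rfl⟩ := (InnerProductSpace.toDual ℝ H).surjective y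
    exact H' h

namespace WeaklyTendsto

variable [CompleteSpace H] {u u' : ℕ → H} {l l' : H}

theorem of_tendsto (h : Tendsto u atTop (𝓝 l)) : WeaklyTendsto u l :=
  weaklyTendsto_iff.2 fun _ => tendsto_const_nhds.inner h

theorem add (h : WeaklyTendsto u l) (h' : WeaklyTendsto u' l') :
    WeaklyTendsto (fun n => u n + u' n) (l + l') :=
  weaklyTendsto_iff.2 fun w => by
    simpa only [inner_add_right] using (weaklyTendsto_iff.1 h w).add (weaklyTendsto_iff.1 h' w)

theorem sub (h : WeaklyTendsto u l) (h' : WeaklyTendsto u' l') :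
    WeaklyTendsto (fun n => u n - u' n) (l - l') :=
  weaklyTendsto_iff.2 fun w => by
    simpa only [inner_sub_right] using (weaklyTendsto_iff.1 h w).sub (weaklyTendsto_iff.1 h' w)

theorem map {H' : Type*} [NormedAddCommGroup H'] [InnerProductSpace ℝ H'] [CompleteSpace H']
    (h : WeaklyTendsto u l) (T : H →L[ℝ] H') :
    WeaklyTendsto (fun n => T (u n)) (T l) :=
  weaklyTendsto_iff.2 fun w => by
    simpa only [ContinuousLinearMap.adjoint_inner_left] using weaklyTendsto_iff.1 h (T.adjoint w)

theorem unique (h : WeaklyTendsto u l) (h' : WeaklyTendsto u l') : l = l' :=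
  ext_inner_left ℝ fun w =>
    tendsto_nhds_unique (weaklyTendsto_iff.1 h w) (weaklyTendsto_iff.1 h' w)

theorem exists_norm_le (h : WeaklyTendsto u l) : ∃ R, ∀ n, ‖u n‖ ≤ R := by
  obtain ⟨R, hR⟩ := banach_steinhaus (g := fun n => InnerProductSpace.toDual ℝ H (u n))
    fun w => by
      have h1 := (weaklyTendsto_iff.1 h w).norm.bddAbove_range
      obtain ⟨R, hR⟩ := h1
      refine ⟨R, fun n => ?_⟩
      rw [InnerProductSpace.toDual_apply_apply, real_inner_comm]
      exact hR ⟨n, rfl⟩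
  refine ⟨R, fun n => ?_⟩
  simpa using hR n

/-- The inner product passes to the limit when one factor converges weakly and the other
strongly. -/
theorem inner_tendsto (h : WeaklyTendsto u l) (h' : Tendsto u' atTop (𝓝 l')) :
    Tendsto (fun n => ⟪u n, u' n⟫_ℝ) atTop (𝓝 ⟪l, l'⟫_ℝ) := by
  obtain ⟨R, hR⟩ := h.exists_norm_le
  have h1 : Tendsto (fun n => ⟪u n, u' n - l'⟫_ℝ) atTop (𝓝 0) := by
    have h2 : Tendsto (fun n => R * ‖u' n - l'‖) atTop (𝓝 0) := by
      simpa using (tendsto_iff_norm_sub_tendsto_zero.1 h').const_mul R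
    refine squeeze_zero_norm (fun n => ?_) h2
    exact (norm_inner_le_norm _ _).trans (mul_le_mul_of_nonneg_right (hR n) (norm_nonneg _))
  have h2 := weaklyTendsto_iff.1 h l'
  rw [real_inner_comm] at h2
  refine (zero_add ⟪l, l'⟫_ℝ ▸ h1.add h2).congr fun n => ?_
  rw [inner_sub_right, real_inner_comm (u n) l']
  ring

end WeaklyTendsto

/-- Riesz representation moves the sequence to the dual, where separability makes closed balls
sequentially weak-* compact. -/
theorem exists_weaklyTendsto_subseq [CompleteSpace H] [SecondCountableTopology H] {u : ℕ → H}
    {R : ℝ} (hu : ∀ n, ‖u n‖ ≤ R) :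
    ∃ (l : H) (φ : ℕ → ℕ), StrictMono φ ∧ WeaklyTendsto (fun n => u (φ n)) l := by
  obtain ⟨a, -, φ, hφ, ha⟩ := WeakDual.isSeqCompact_closedBall ℝ H 0 R
    (x := fun n => StrongDual.toWeakDual (InnerProductSpace.toDual ℝ H (u n)))
    fun n => by simpa using hu n
  obtain ⟨l, hl⟩ := (InnerProductSpace.toDual ℝ H).surjective (WeakDual.toStrongDual a)
  refine ⟨l, φ, hφ, weaklyTendsto_iff.2 fun h => ?_⟩
  have h1 := (WeakDual.eval_continuous h).continuousAt.tendsto.comp ha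
  have h2 : a h = ⟪h, l⟫_ℝ := by
    rw [real_inner_comm, ← InnerProductSpace.toDual_apply_apply (𝕜 := ℝ), hl]
    rfl
  rw [← h2]
  refine h1.congr fun n => ?_
  exact real_inner_comm _ _

/-- **Opial's lemma** for the form of a strongly positive self-adjoint operator. The convergence of
the distances is only required from the points of a dense subset `D` of the target set `S`. -/
theorem exists_weaklyTendsto_of_opial [CompleteSpace H] [SecondCountableTopology H] {U : H →L[ℝ] H}
    (hU : IsSelfAdjoint U) (hUp : StronglyPositive U) {S D : Set H} (hD : S ⊆ closure D)
    (hDne : D.Nonempty) {u : ℕ → H}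
    (hlim : ∀ z ∈ D, ∃ l, Tendsto (fun n => ⟪U (u n - z), u n - z⟫_ℝ) atTop (𝓝 l))
    (hcl : ∀ (φ : ℕ → ℕ) (l : H), StrictMono φ → WeaklyTendsto (fun n => u (φ n)) l → l ∈ S) :
    ∃ l ∈ S, WeaklyTendsto u l := by
  obtain ⟨χ, hχ, hUχ⟩ := hUp
  have hsym : ∀ x y, ⟪U x, y⟫_ℝ = ⟪x, U y⟫_ℝ := hU.isSymmetric
  obtain ⟨R, hR⟩ : ∃ R, ∀ n, ‖u n‖ ≤ R := by
    obtain ⟨z, hz⟩ := hDne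
    obtain ⟨l, hl⟩ := hlim z hz
    obtain ⟨R, hR⟩ := hl.bddAbove_range
    refine ⟨√(R / χ) + ‖z‖, fun n => ?_⟩
    have h1 : ‖u n - z‖ ≤ √(R / χ) := by
      refine Real.le_sqrt_of_sq_le ?_
      rw [le_div_iff₀ hχ, mul_comm]
      exact (hUχ _).trans (hR ⟨n, rfl⟩)
    linarith [norm_le_norm_sub_add (u n) z]
  have huniq : ∀ (φ ψ : ℕ → ℕ) (a b : H), StrictMono φ → StrictMono ψ →
      WeaklyTendsto (fun n => u (φ n)) a → WeaklyTendsto (fun n => u (ψ n)) b → a = b := by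
    intro φ ψ a b hφ hψ ha hb
    have h1 : ∀ z ∈ D, ∀ z' ∈ D, ⟪U (z - z'), a - b⟫_ℝ = 0 := by
      intro z hz z' hz'
      obtain ⟨l, hl⟩ := hlim z hz
      obtain ⟨l', hl'⟩ := hlim z' hz'
      -- Polarisation: the difference of the squared U-distances to z' and z is affine in u_n.
      have h2 : Tendsto (fun n => ⟪U (z - z'), u n⟫_ℝ) atTop
          (𝓝 ((l' - l + (⟪U z, z⟫_ℝ - ⟪U z', z'⟫_ℝ)) / 2)) := by
        refine (((hl'.sub hl).add tendsto_const_nhds).div_const 2).congr fun n => ?_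
        simp only [map_sub, inner_sub_left, inner_sub_right]
        rw [hsym (u n) z, hsym (u n) z', real_inner_comm (U z), real_inner_comm (U z')]
        ring
      have h3 := tendsto_nhds_unique (h2.comp hφ.tendsto_atTop)
        (weaklyTendsto_iff.1 ha (U (z - z')))
      have h4 := tendsto_nhds_unique (h2.comp hψ.tendsto_atTop)
        (weaklyTendsto_iff.1 hb (U (z - z')))
      rw [inner_sub_right, ← h3, ← h4, sub_self]
    -- The orthogonality is a closed condition on (z, z'), so it reaches the cluster points a and b
    -- themselves; taking z = a, z' = b forces a = b.
    have h5 : ∀ z ∈ closure D, ∀ z' ∈ closure D, ⟪U (z - z'), a - b⟫_ℝ = 0 := by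
      intro z hz z' hz'
      have hmem : (z, z') ∈ closure (D ×ˢ D) := by
        rw [closure_prod_eq]
        exact ⟨hz, hz'⟩
      have hcl : IsClosed {p : H × H | ⟪U (p.1 - p.2), a - b⟫_ℝ = 0} :=
        isClosed_eq (by fun_prop) continuous_const
      exact hcl.closure_subset_iff.2 (fun p hp => h1 _ hp.1 _ hp.2) hmem
    have h6 := hUχ (a - b)
    rw [h5 a (hD (hcl φ a hφ ha)) b (hD (hcl ψ b hψ hb))] at h6
    have h7 : ‖a - b‖ ^ 2 ≤ 0 := nonpos_of_mul_nonpos_right h6 hχ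
    exact sub_eq_zero.1 (norm_eq_zero.1 (pow_eq_zero_iff two_ne_zero |>.1
      (le_antisymm h7 (sq_nonneg _))))
  obtain ⟨l, φ, hφ, hl⟩ := exists_weaklyTendsto_subseq hR
  refine ⟨l, hcl φ l hφ hl, weaklyTendsto_iff.2 fun h => ?_⟩
  refine tendsto_of_subseq_tendsto fun ns hns => ?_
  obtain ⟨φ', -, hφ'⟩ := strictMono_subseq_of_tendsto_atTop hns
  obtain ⟨l', ψ, hψ, hl'⟩ := exists_weaklyTendsto_subseq (u := fun n => u (ns (φ' n)))
    fun n => hR _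
  have := huniq φ (fun n => ns (φ' (ψ n))) l l' hφ (hφ'.comp hψ) hl hl'
  subst this
  exact ⟨fun n => φ' (ψ n), weaklyTendsto_iff.1 hl' h⟩

section Measurability

variable [CompleteSpace H] [SecondCountableTopology H] [MeasurableSpace H] [BorelSpace H]
  {Ω : Type*} [MeasurableSpace Ω]

/-- In a separable Hilbert space, weak measurability implies measurability. -/
theorem measurable_of_forall_inner {f : Ω → H} (hf : ∀ h, Measurable fun ω => ⟪h, f ω⟫_ℝ) :
    Measurable f := by
  -- Pairing with a dense sequence is a continuous injection of a Polish space into ℝ^ℕ, hence a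
  -- measurable embedding by Lusin–Souslin.
  let Φ : H → ℕ → ℝ := fun x n => ⟪TopologicalSpace.denseSeq H n, x⟫_ℝ
  have hΦ : Continuous Φ := continuous_pi fun n => continuous_const.inner continuous_id
  have hinj : Function.Injective Φ := by
    intro x y hxy
    refine ext_inner_left ℝ fun h => ?_
    have hcl : IsClosed {h : H | ⟪h, x⟫_ℝ = ⟪h, y⟫_ℝ} :=
      isClosed_eq (by fun_prop) (by fun_prop)
    refine hcl.closure_subset_iff.2 ?_ ((TopologicalSpace.denseRange_denseSeq H) h)
    rintro _ ⟨n, rfl⟩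
    exact congrFun hxy n
  exact (hΦ.measurableEmbedding hinj).measurable_comp_iff.1 (measurable_pi_lambda _ fun n => hf _)

/-- The divergence set need not be visibly measurable, so a measurable null superset is removed; off
it each inner product with the limit is a pointwise limit of measurable functions. -/
theorem exists_measurable_weaklyTendsto {P : Measure Ω} {u : ℕ → Ω → H}
    (hu : ∀ n, Measurable (u n)) (hlim : ∀ᵐ ω ∂P, ∃ l, WeaklyTendsto (fun n => u n ω) l) :
    ∃ ubar : Ω → H, Measurable ubar ∧ ∀ᵐ ω ∂P, WeaklyTendsto (fun n => u n ω) (ubar ω) := by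
  classical
  let N := toMeasurable P {ω | ¬ ∃ l, WeaklyTendsto (fun n => u n ω) l}
  have hN : MeasurableSet N := measurableSet_toMeasurable _ _
  have hN0 : P N = 0 := (measure_toMeasurable _).trans hlim
  have hex : ∀ ω, ω ∉ N → ∃ l, WeaklyTendsto (fun n => u n ω) l := fun ω hω => by
    by_contra h
    exact hω (subset_toMeasurable _ _ h)
  let ubar : Ω → H := fun ω => if h : ω ∈ N then 0 else (hex ω h).choose
  have hubar : ∀ ω, ω ∉ N → WeaklyTendsto (fun n => u n ω) (ubar ω) := fun ω hω => by
    simp only [ubar, hω, dite_false]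
    exact (hex ω hω).choose_spec
  refine ⟨ubar, measurable_of_forall_inner fun h => ?_, ?_⟩
  · refine measurable_of_tendsto_metrizable (f := fun n ω => Nᶜ.indicator (fun ω => ⟪h, u n ω⟫_ℝ) ω)
      (fun n => (measurable_const.inner (hu n)).indicator hN.compl) ?_
    refine tendsto_pi_nhds.2 fun ω => ?_
    by_cases hω : ω ∈ N
    · have e : ubar ω = 0 := by simp [ubar, hω]
      simp [hω, e]
    · simpa [hω] using weaklyTendsto_iff.1 (hubar ω hω) h
  · have : ∀ᵐ ω ∂P, ω ∉ N := measure_eq_zero_iff_ae_notMem.1 hN0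
    filter_upwards [this] with ω hω using hubar ω hω

end Measurability

end WeakConvergence

/-! ### Strongly positive metrics, one-step inequalities and cocoercivity. -/

section PositiveOperators

variable {H : Type*} [NormedAddCommGroup H] [InnerProductSpace ℝ H]

theorem StronglyPositive.inner_nonneg {U : H →L[ℝ] H} (hU : StronglyPositive U) (x : H) :
    0 ≤ ⟪U x, x⟫_ℝ := by
  obtain ⟨χ, hχ, h⟩ := hU
  exact (by positivity : 0 ≤ χ * ‖x‖ ^ 2).trans (h x)

/-- Neumann series: a positive multiple of U lies within distance less than 1 of the identity. -/
theorem StronglyPositive.isUnit [CompleteSpace H] {U : H →L[ℝ] H} (hU : StronglyPositive U) :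
    IsUnit U := by
  obtain ⟨t, r, ht0, -, hr1, hUr⟩ := exists_norm_one_sub_smul_le hU
  have h1 : IsUnit (t • U) := by
    simpa using isUnit_one_sub_of_norm_lt_one (hUr.trans_lt hr1)
  exact (isUnit_smul_iff (Units.mk0 t ht0.ne') U).1 h1

theorem exists_rightInverse_leftInverse_of_isUnit {U : H →L[ℝ] H} (hU : IsUnit U) :
    ∃ R : H →L[ℝ] H, (∀ x, U (R x) = x) ∧ ∀ x, R (U x) = x := by
  obtain ⟨u, rfl⟩ := hU
  exact ⟨↑u⁻¹, fun x => DFunLike.congr_fun u.mul_inv x, fun x => DFunLike.congr_fun u.inv_mul x⟩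

theorem StronglyPositive.tendsto_zero {U : H →L[ℝ] H} (hU : StronglyPositive U) {u : ℕ → H}
    (h : Tendsto (fun n => ⟪U (u n), u n⟫_ℝ) atTop (𝓝 0)) : Tendsto u atTop (𝓝 0) := by
  obtain ⟨χ, hχ, hUχ⟩ := hU
  have h1 : Tendsto (fun n => √(⟪U (u n), u n⟫_ℝ / χ)) atTop (𝓝 0) := by
    simpa using (h.div_const χ).sqrt
  refine squeeze_zero_norm (fun n => Real.le_sqrt_of_sq_le ?_) h1
  rw [le_div_iff₀ hχ, mul_comm]
  exact hUχ _

/-- One step of the perturbed forward-backward iteration: `A` and `D` are the distances of the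
current point to a zero and to the next point, `g` and `f` are the forward step and the
perturbation. -/
theorem forwardBackward_step_le {U : H →L[ℝ] H} (hsym : ∀ x y, ⟪U x, y⟫_ℝ = ⟪x, U y⟫_ℝ) {β : ℝ}
    {A D g f : H} (hmono : 0 ≤ ⟪A - D, U D - U g - U f⟫_ℝ)
    (hcoco : β * ⟪U g, g⟫_ℝ ≤ ⟪A, U g⟫_ℝ) :
    ⟪U (A - D), A - D⟫_ℝ + ((2 * β - 1) * ⟪U g, g⟫_ℝ + ⟪U (D - g - f), D - g - f⟫_ℝ) ≤
      ⟪U A, A⟫_ℝ + ⟪U f, f⟫_ℝ - 2 * ⟪A - g, U f⟫_ℝ := by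
  have s : ∀ x y, ⟪x, U y⟫_ℝ = ⟪y, U x⟫_ℝ := fun x y => by rw [← hsym, real_inner_comm]
  -- After expansion the claim is twice `hmono` plus twice `hcoco`. The cross term with f involves
  -- only A - g, not the next point D, so it will have zero conditional mean.
  simp only [map_sub, inner_sub_left, inner_sub_right, hsym] at hmono hcoco ⊢
  simp only [s D A, s g D, s f D, s f g] at hmono hcoco ⊢
  linarith

/-- Convexity of the squared U-norm; the defect dropped is l (1 - l) times the squared U-norm of t -
x. -/
theorem inner_relaxation_le {U : H →L[ℝ] H} (hsym : ∀ x y, ⟪U x, y⟫_ℝ = ⟪x, U y⟫_ℝ)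
    (hU : ∀ x, 0 ≤ ⟪U x, x⟫_ℝ) {l : ℝ} (hl0 : 0 ≤ l) (hl1 : l ≤ 1) (x t z : H) :
    ⟪U (x + l • (t - x) - z), x + l • (t - x) - z⟫_ℝ ≤
      (1 - l) * ⟪U (x - z), x - z⟫_ℝ + l * ⟪U (t - z), t - z⟫_ℝ := by
  have e : x + l • (t - x) - z = (1 - l) • (x - z) + l • (t - z) := by module
  have e2 : t - x = (t - z) - (x - z) := by abel
  have h := mul_nonneg (mul_nonneg hl0 (sub_nonneg.2 hl1)) (hU (t - x))
  rw [e]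
  rw [e2] at h
  generalize t - z = b at *
  generalize x - z = a at *
  have s : ⟪b, U a⟫_ℝ = ⟪a, U b⟫_ℝ := by rw [← hsym, real_inner_comm]
  simp only [map_sub, map_add, map_smul, inner_sub_left, inner_sub_right, inner_add_left,
    inner_add_right, inner_smul_left, inner_smul_right, hsym, s, RCLike.conj_to_real] at *
  linarith

/-- Young's inequality on the cross term, together with l² ≤ l. -/
theorem inner_inertia_le {U : H →L[ℝ] H} (hsym : ∀ x y, ⟪U x, y⟫_ℝ = ⟪x, U y⟫_ℝ)
    (hU : ∀ x, 0 ≤ ⟪U x, x⟫_ℝ) {l : ℝ} (hl0 : 0 ≤ l) (hl1 : l ≤ 1) (x d : H) :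
    ⟪U (x + l • d), x + l • d⟫_ℝ ≤ (1 + l) * ⟪U x, x⟫_ℝ + 2 * l * ⟪U d, d⟫_ℝ := by
  have h := mul_nonneg hl0 (hU (x - d))
  have h2 := mul_nonneg (mul_nonneg hl0 (sub_nonneg.2 hl1)) (hU d)
  have s : ⟪d, U x⟫_ℝ = ⟪x, U d⟫_ℝ := by rw [← hsym, real_inner_comm]
  simp only [map_sub, map_add, map_smul, inner_sub_left, inner_sub_right, inner_add_left,
    inner_add_right, inner_smul_left, inner_smul_right, hsym, s, RCLike.conj_to_real] at *
  linarith

/-- Cocoercivity with respect to the norm of `U` gives cocoercivity with respect to the ambient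
norm. -/
theorem exists_cocoercive [CompleteSpace H] {U : H →L[ℝ] H} (hUp : StronglyPositive U) {Q : H → H}
    {β : ℝ} (hβ : 0 < β)
    (hQ : ∀ x y h, U h = Q x - Q y → β * ⟪U h, h⟫_ℝ ≤ ⟪x - y, Q x - Q y⟫_ℝ) :
    ∃ κ : ℝ, 0 < κ ∧ ∀ x y, κ * ‖Q x - Q y‖ ^ 2 ≤ ⟪x - y, Q x - Q y⟫_ℝ := by
  obtain ⟨R, hR, -⟩ := exists_rightInverse_leftInverse_of_isUnit hUp.isUnit
  obtain ⟨χ, hχ, hUχ⟩ := hUp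
  refine ⟨β * χ / (‖U‖ ^ 2 + 1), by positivity, fun x y => ?_⟩
  have h1 := hQ x y (R (Q x - Q y)) (hR _)
  have h2 : ‖Q x - Q y‖ ^ 2 ≤ (‖U‖ ^ 2 + 1) * ‖R (Q x - Q y)‖ ^ 2 := by
    conv_lhs => rw [← hR (Q x - Q y)]
    have := pow_le_pow_left₀ (norm_nonneg _) (U.le_opNorm (R (Q x - Q y))) 2
    nlinarith [sq_nonneg ‖R (Q x - Q y)‖]
  refine le_trans ?_ ((mul_le_mul_of_nonneg_left (hUχ _) hβ.le).trans h1)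
  rw [div_mul_eq_mul_div, div_le_iff₀ (by positivity)]
  calc β * χ * ‖Q x - Q y‖ ^ 2 ≤ β * χ * ((‖U‖ ^ 2 + 1) * ‖R (Q x - Q y)‖ ^ 2) :=
        mul_le_mul_of_nonneg_left h2 (by positivity)
    _ = _ := by ring

theorem norm_sub_le_of_cocoercive {Q : H → H} {κ : ℝ} (hκ : 0 < κ) {x y : H}
    (h : κ * ‖Q x - Q y‖ ^ 2 ≤ ⟪x - y, Q x - Q y⟫_ℝ) : ‖Q x - Q y‖ ≤ κ⁻¹ * ‖x - y‖ := by
  rcases (norm_nonneg (Q x - Q y)).eq_or_lt with h0 | h0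
  · rw [← h0]
    positivity
  · have h1 := h.trans (real_inner_le_norm _ _)
    rw [inv_mul_eq_div, le_div_iff₀ hκ]
    refine le_of_mul_le_mul_right ?_ h0
    linarith

theorem lipschitzWith_of_cocoercive {Q : H → H} {κ : ℝ} (hκ : 0 < κ)
    (h : ∀ x y, κ * ‖Q x - Q y‖ ^ 2 ≤ ⟪x - y, Q x - Q y⟫_ℝ) :
    LipschitzWith (κ⁻¹).toNNReal Q := by
  refine LipschitzWith.of_dist_le_mul fun x y => ?_
  rw [dist_eq_norm, dist_eq_norm, Real.coe_toNNReal _ (inv_nonneg.2 hκ.le)]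
  exact norm_sub_le_of_cocoercive hκ (h x y)

theorem LipschitzWith.comp_memLp_of_isFiniteMeasure {Ω E E' : Type*}
    {m0 : MeasurableSpace Ω} {P : Measure Ω} [IsFiniteMeasure P]
    [NormedAddCommGroup E] [NormedAddCommGroup E'] {K : NNReal} {f : E → E'}
    (hf : LipschitzWith K f) {u : Ω → E} {p : ENNReal} (hu : MemLp u p P) :
    MemLp (fun ω => f (u ω)) p P := by
  have h1 : MemLp (fun ω => f (u ω) - f 0) p P := by
    refine MemLp.of_le_mul (c := K) hu ((hf.continuous.comp_aestronglyMeasurable hu.1).sub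
      aestronglyMeasurable_const) (ae_of_all _ fun ω => ?_)
    simpa [dist_eq_norm] using hf.dist_le_mul (u ω) 0
  exact (h1.add (memLp_const (f 0))).congr_norm
    (hf.continuous.comp_aestronglyMeasurable hu.1) (ae_of_all _ fun ω => by simp)

theorem MeasureTheory.MemLp.integrable_inner_two {Ω : Type*} {m0 : MeasurableSpace Ω}
    {P : Measure Ω} {f g : Ω → H} (hf : MemLp f 2 P) (hg : MemLp g 2 P) :
    Integrable (fun ω => ⟪f ω, g ω⟫_ℝ) P := by
  refine Integrable.mono' (hf.norm.integrable_mul hg.norm) (hf.1.inner hg.1)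
    (ae_of_all _ fun ω => norm_inner_le_norm _ _)

end PositiveOperators

/-- Integrating a sum in which one summand is replaced by another one with the same integral. -/
theorem integral_add_add_sub_eq_of_integral_eq {Ω : Type*} {m0 : MeasurableSpace Ω} {μ : Measure Ω}
    {f₁ f₂ f₃ f₄ f₅ : Ω → ℝ} (h₁ : Integrable f₁ μ) (h₂ : Integrable f₂ μ) (h₃ : Integrable f₃ μ)
    (h₄ : Integrable f₄ μ) (h₅ : Integrable f₅ μ) (h₃₅ : ∫ ω, f₃ ω ∂μ = ∫ ω, f₅ ω ∂μ)
    (h₄₀ : ∫ ω, f₄ ω ∂μ = 0) :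
    ∫ ω, (f₁ + f₂ + f₃ - f₄) ω ∂μ = ∫ ω, f₁ ω + (f₂ ω + f₅ ω) ∂μ := by
  rw [integral_sub' ((h₁.add h₂).add h₃) h₄, integral_add' (h₁.add h₂) h₃, integral_add' h₁ h₂,
    integral_add (g := fun ω => f₂ ω + f₅ ω) h₁ (h₂.add h₅), integral_add h₂ h₅, h₃₅, h₄₀]
  ring

/-! ### The inertial stochastic forward-backward method in a variable metric. -/

section StochasticForwardBackward

variable {H : Type*} [NormedAddCommGroup H] [InnerProductSpace ℝ H] [CompleteSpace H]
  [SecondCountableTopology H] [MeasurableSpace H] [BorelSpace H]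
  {Ω : Type*} {m0 : MeasurableSpace Ω}

/-- A run of the inertial stochastic forward-backward iteration for the inclusion `0 ∈ M x + Q x`
in the metric of `U`: from the extrapolated point `C n`, the backward step `T n` uses the unbiased
approximation `a n` of `Q (C n)`, and the relaxed update is `X (n + 1)`. -/
structure IsStochasticForwardBackward (P : Measure Ω) (F : Filtration ℕ m0) (U : H →L[ℝ] H)
    (M : H → Set H) (Q : H → H) (β ε : ℝ) (lam α : ℕ → ℝ) (a X C T : ℕ → Ω → H) : Prop where
  isSelfAdjoint : IsSelfAdjoint U
  stronglyPositive : StronglyPositive U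
  monotone : MonotoneOp M
  one_lt : 1 < 2 * β
  cocoercive : ∀ x y h, U h = Q x - Q y → β * ⟪U h, h⟫_ℝ ≤ ⟪x - y, Q x - Q y⟫_ℝ
  eps_pos : 0 < ε
  lam_mem : ∀ n, lam n ∈ Set.Icc ε 1
  alpha_mem : ∀ n, α n ∈ Set.Icc 0 1
  summable_alpha : Summable α
  memLp_approx : ∀ n, MemLp (a n) 2 P
  adapted : ∀ n, Measurable[F n] (X n)
  memLp_iterate : ∀ n, MemLp (X n) 2 P
  memLp_backward : ∀ n, MemLp (T n) 2 P
  extrapolation : ∀ n ω, C n ω = X n ω + α n • (X n ω - X (n - 1) ω)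
  backward : ∀ n ω, U (C n ω - T n ω) - a n ω ∈ M (T n ω)
  update : ∀ n ω, X (n + 1) ω = X n ω + lam n • (T n ω - X n ω)
  condExp_approx : ∀ n, P[a n | F n] =ᵐ[P] fun ω => Q (C n ω)
  summable_variance : ∀ᵐ ω ∂P, Summable fun n => (P[fun ω' => ‖a n ω' - Q (C n ω')‖ ^ 2 | F n]) ω
  bddAbove_increment : ∀ᵐ ω ∂P, BddAbove (Set.range fun n => ‖X n ω - X (n - 1) ω‖)

namespace IsStochasticForwardBackward

variable {P : Measure Ω} [IsProbabilityMeasure P] {F : Filtration ℕ m0} {U : H →L[ℝ] H}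
  {M : H → Set H} {Q : H → H} {β ε : ℝ} {lam α : ℕ → ℝ} {a X C T : ℕ → Ω → H}

-- Relaxation, forward-backward and inertia estimates are chained, with R = U⁻¹ applied to the
-- forward difference and to the noise. The relaxation factor l is replaced by e on the nonnegative
-- residual and by 1 on the nonnegative errors, but stays exact on the cross term, whose sign is
-- unknown.
omit [MeasurableSpace H] [BorelSpace H] [SecondCountableTopology H] in
theorem inner_step_le (hU : IsSelfAdjoint U) (hUp : StronglyPositive U) (hM : MonotoneOp M)
    {l e : ℝ} (hl : l ∈ Set.Icc e 1) (he : 0 < e) {t : ℝ} (ht : t ∈ Set.Icc (0 : ℝ) 1)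
    (hβ : 1 < 2 * β) (hQ : ∀ x y h, U h = Q x - Q y → β * ⟪U h, h⟫_ℝ ≤ ⟪x - y, Q x - Q y⟫_ℝ)
    {R : H →L[ℝ] H} (hR : ∀ x, U (R x) = x) {z : H} (hz : -Q z ∈ M z) {x x' c w p : H}
    (hc : c = x + t • (x - x')) (hp : U (c - p) - w ∈ M p) :
    ⟪U (x + l • (p - x) - z), x + l • (p - x) - z⟫_ℝ +
      e * ((2 * β - 1) * ⟪U (R (Q c - Q z)), R (Q c - Q z)⟫_ℝ +
        ⟪U (c - p - R (Q c - Q z) - R (w - Q c)), c - p - R (Q c - Q z) - R (w - Q c)⟫_ℝ) ≤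
      (1 + t) * ⟪U (x - z), x - z⟫_ℝ + 2 * t * ⟪U (x - x'), x - x'⟫_ℝ +
        ‖R‖ * ‖w - Q c‖ ^ 2 - 2 * l * ⟪c - z - R (Q c - Q z), w - Q c⟫_ℝ := by
  have hsym : ∀ x y, ⟪U x, y⟫_ℝ = ⟪x, U y⟫_ℝ := hU.isSymmetric
  have hnn := hUp.inner_nonneg
  have hl0 : 0 ≤ l := he.le.trans hl.1
  have h1 := inner_relaxation_le hsym hnn hl0 hl.2 x p z
  have h2 := inner_inertia_le hsym hnn ht.1 ht.2 (x - z) (x - x')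
  have e2 : x - z + t • (x - x') = c - z := by rw [hc]; abel
  rw [e2] at h2
  have e3 : c - z - (c - p) = p - z := by abel
  have h3 := forwardBackward_step_le (A := c - z) (D := c - p) (g := R (Q c - Q z))
    (f := R (w - Q c)) (β := β) hsym (by
      have := hM p z _ _ hp hz
      rw [hR, hR, e3]
      convert! this using 2
      abel) (by
      have := hQ c z (R (Q c - Q z)) (hR _)
      rwa [hR] at this ⊢)
  rw [e3, hR (w - Q c)] at h3
  have h4 : ⟪w - Q c, R (w - Q c)⟫_ℝ ≤ ‖R‖ * ‖w - Q c‖ ^ 2 := by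
    refine (real_inner_le_norm _ _).trans ?_
    have := mul_le_mul_of_nonneg_left (R.le_opNorm (w - Q c)) (norm_nonneg (w - Q c))
    linarith
  have h5 : 0 ≤ ‖R‖ * ‖w - Q c‖ ^ 2 := by positivity
  set θ := (2 * β - 1) * ⟪U (R (Q c - Q z)), R (Q c - Q z)⟫_ℝ +
        ⟪U (c - p - R (Q c - Q z) - R (w - Q c)), c - p - R (Q c - Q z) - R (w - Q c)⟫_ℝ
  have hθ : 0 ≤ θ := add_nonneg (mul_nonneg (by linarith) (hnn _)) (hnn _)
  have h6 := mul_le_mul_of_nonneg_right hl.1 hθ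
  have h7 := mul_le_mul_of_nonneg_left h3 hl0
  have h8 := mul_le_mul_of_nonneg_left h2 hl0
  have h9 := mul_le_mul_of_nonneg_left h4 hl0
  have h10 := mul_le_mul_of_nonneg_right hl.2 h5
  have h11 := mul_le_mul_of_nonneg_right hl.2 (mul_nonneg ht.1 (hnn (x - z)))
  have h12 := mul_le_mul_of_nonneg_right hl.2 (mul_nonneg ht.1 (hnn (x - x')))
  linarith

variable (h : IsStochasticForwardBackward P F U M Q β ε lam α a X C T)

include h

omit [SecondCountableTopology H] [BorelSpace H] [IsProbabilityMeasure P] in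
theorem exists_lipschitz : ∃ K, LipschitzWith K Q := by
  obtain ⟨κ, hκ, hQ⟩ := exists_cocoercive h.stronglyPositive
    (show 0 < β by linarith [h.one_lt]) h.cocoercive
  exact ⟨_, lipschitzWith_of_cocoercive hκ hQ⟩

omit [SecondCountableTopology H] [BorelSpace H] [IsProbabilityMeasure P] in
theorem measurable_prev (n : ℕ) : Measurable[F n] (X (n - 1)) :=
  (h.adapted (n - 1)).mono (F.mono (Nat.sub_le n 1)) le_rfl

omit [IsProbabilityMeasure P] in
theorem measurable_extrapolation (n : ℕ) : Measurable[F n] (C n) := by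
  have e : C n = fun ω => X n ω + α n • (X n ω - X (n - 1) ω) := funext (h.extrapolation n)
  rw [e]
  exact (h.adapted n).add (((h.adapted n).sub (h.measurable_prev n)).const_smul _)

omit [SecondCountableTopology H] [BorelSpace H] [IsProbabilityMeasure P] in
theorem memLp_extrapolation (n : ℕ) : MemLp (C n) 2 P := by
  have e : C n = X n + α n • (X n - X (n - 1)) := funext (h.extrapolation n)
  rw [e]
  exact (h.memLp_iterate n).add (((h.memLp_iterate n).sub (h.memLp_iterate _)).const_smul _)

/-- Almost sure convergence of the distances to a zero, and of the residuals. -/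
theorem ae_tendsto_of_zero {z : H} (hz : -Q z ∈ M z) : ∀ᵐ ω ∂P,
    (∃ l, Tendsto (fun n => ⟪U (X n ω - z), X n ω - z⟫_ℝ) atTop (𝓝 l)) ∧
      Tendsto (fun n => Q (C n ω)) atTop (𝓝 (Q z)) ∧
      Tendsto (fun n => a n ω - Q (C n ω)) atTop (𝓝 0) ∧
      Tendsto (fun n => C n ω - T n ω) atTop (𝓝 0) := by
  obtain ⟨K, hK⟩ := h.exists_lipschitz
  obtain ⟨R, hR, -⟩ := exists_rightInverse_leftInverse_of_isUnit h.stronglyPositive.isUnit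
  have hnn := h.stronglyPositive.inner_nonneg
  have hint : ∀ {f : Ω → H}, MemLp f 2 P → Integrable (fun ω => ⟪U (f ω), f ω⟫_ℝ) P :=
    fun {f} hf => (U.comp_memLp' hf).integrable_inner_two hf
  have hQC : ∀ n, MemLp (fun ω => Q (C n ω)) 2 P := fun n =>
    hK.comp_memLp_of_isFiniteMeasure (h.memLp_extrapolation n)
  have he2 : ∀ n, MemLp (fun ω => a n ω - Q (C n ω)) 2 P := fun n =>
    (h.memLp_approx n).sub (hQC n)
  have hg2 : ∀ n, MemLp (fun ω => R (Q (C n ω) - Q z)) 2 P := fun n =>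
    R.comp_memLp' ((hQC n).sub (memLp_const _))
  have hd2 : ∀ n, MemLp (fun ω => X n ω - X (n - 1) ω) 2 P := fun n =>
    (h.memLp_iterate n).sub (h.memLp_iterate _)
  have hξ2 : ∀ n, MemLp (fun ω => X n ω - z) 2 P := fun n =>
    (h.memLp_iterate n).sub (memLp_const _)
  have hY2 : ∀ n, MemLp (fun ω => C n ω - z - R (Q (C n ω) - Q z)) 2 P := fun n =>
    ((h.memLp_extrapolation n).sub (memLp_const _)).sub (hg2 n)
  have hr2 : ∀ n, MemLp
      (fun ω => C n ω - T n ω - R (Q (C n ω) - Q z) - R (a n ω - Q (C n ω))) 2 P :=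
    fun n => (((h.memLp_extrapolation n).sub (h.memLp_backward n)).sub (hg2 n)).sub
      (R.comp_memLp' (he2 n))
  have hes : ∀ n, Integrable (fun ω => ‖a n ω - Q (C n ω)‖ ^ 2) P := fun n =>
    (he2 n).norm.integrable_sq
  have hYe : ∀ n, Integrable
      (fun ω => ⟪C n ω - z - R (Q (C n ω) - Q z), a n ω - Q (C n ω)⟫_ℝ) P := fun n =>
    (hY2 n).integrable_inner_two (he2 n)
  have hYm : ∀ n, StronglyMeasurable[F n] fun ω => C n ω - z - R (Q (C n ω) - Q z) := fun n => by
    have hcont : Continuous fun c => c - z - R (Q c - Q z) := by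
      have := hK.continuous
      fun_prop
    exact hcont.comp_stronglyMeasurable (h.measurable_extrapolation n).stronglyMeasurable
  -- The left factor is known at time n and the noise has zero conditional mean, so the pull-out
  -- property kills the cross term.
  have horth : ∀ n S, MeasurableSet[F n] S →
      ∫ ω in S, ⟪C n ω - z - R (Q (C n ω) - Q z), a n ω - Q (C n ω)⟫_ℝ ∂P = 0 := by
    intro n S hS
    have hcond : P[fun ω => a n ω - Q (C n ω) | F n] =ᵐ[P] 0 := by
      have h1 : P[fun ω => Q (C n ω) | F n] = fun ω => Q (C n ω) :=
        condExp_of_stronglyMeasurable (F.le n) (hK.continuous.comp_stronglyMeasurable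
          (h.measurable_extrapolation n).stronglyMeasurable) ((hQC n).integrable one_le_two)
      have h2 := condExp_sub ((h.memLp_approx n).integrable one_le_two)
        ((hQC n).integrable one_le_two) (F n)
      filter_upwards [h2, h.condExp_approx n] with ω h2 h3
      change (P[a n - fun ω => Q (C n ω) | F n]) ω = 0
      rw [h2, Pi.sub_apply, h1, h3, sub_self]
    have hpull := condExp_bilin_of_stronglyMeasurable_left (innerSL ℝ) (hYm n) (hYe n)
      ((he2 n).integrable one_le_two)
    rw [← setIntegral_condExp (F.le n) (hYe n) hS]
    refine integral_eq_zero_of_ae (ae_restrict_of_ae ?_)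
    filter_upwards [hpull, hcond] with ω h1 h2
    refine h1.trans ?_
    rw [h2]
    simp
  have hθi : ∀ n, Integrable (fun ω => ε * ((2 * β - 1) *
      ⟪U (R (Q (C n ω) - Q z)), R (Q (C n ω) - Q z)⟫_ℝ +
        ⟪U (C n ω - T n ω - R (Q (C n ω) - Q z) - R (a n ω - Q (C n ω))),
          C n ω - T n ω - R (Q (C n ω) - Q z) - R (a n ω - Q (C n ω))⟫_ℝ)) P := fun n =>
    (((hint (hg2 n)).const_mul _).add (hint (hr2 n))).const_mul _
  have hηi : ∀ n, Integrable (fun ω => 2 * α n * ⟪U (X n ω - X (n - 1) ω), X n ω - X (n - 1) ω⟫_ℝ +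
      ‖R‖ * (P[fun ω' => ‖a n ω' - Q (C n ω')‖ ^ 2 | F n]) ω) P := fun n =>
    ((hint (hd2 n)).const_mul _).add (integrable_condExp.const_mul _)
  -- Here θ contains `T n` and `a n`, so it need not be adapted, while η must be and thus carries
  -- the conditional variance instead of the squared noise.
  have hRS := robbins_siegmund (P := P) (F := F) (γ := α)
    (ξ := fun n ω => ⟪U (X n ω - z), X n ω - z⟫_ℝ)
    (θ := fun n ω => ε * ((2 * β - 1) *
      ⟪U (R (Q (C n ω) - Q z)), R (Q (C n ω) - Q z)⟫_ℝ +
        ⟪U (C n ω - T n ω - R (Q (C n ω) - Q z) - R (a n ω - Q (C n ω))),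
          C n ω - T n ω - R (Q (C n ω) - Q z) - R (a n ω - Q (C n ω))⟫_ℝ))
    (η := fun n ω => 2 * α n * ⟪U (X n ω - X (n - 1) ω), X n ω - X (n - 1) ω⟫_ℝ +
      ‖R‖ * (P[fun ω' => ‖a n ω' - Q (C n ω')‖ ^ 2 | F n]) ω)
    (fun n => (h.alpha_mem n).1) h.summable_alpha
    (fun n => by
      have hcont : Continuous fun x => ⟪U (x - z), x - z⟫_ℝ := by fun_prop
      exact hcont.comp_stronglyMeasurable (h.adapted n).stronglyMeasurable)
    (fun n => hint (hξ2 n)) (fun n ω => hnn _) hθi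
    (fun n ω => mul_nonneg h.eps_pos.le (add_nonneg
      (mul_nonneg (by linarith [h.one_lt]) (hnn _)) (hnn _)))
    (fun n => by
      have hcont : Continuous fun x => ⟪U x, x⟫_ℝ := by fun_prop
      exact ((hcont.comp_stronglyMeasurable ((h.adapted n).sub
        (h.measurable_prev n)).stronglyMeasurable).const_mul _).add
        (stronglyMeasurable_condExp.const_mul _))
    hηi
    (fun n S hS => by
      have hb := fun ω => inner_step_le h.isSelfAdjoint h.stronglyPositive h.monotone
        (h.lam_mem n) h.eps_pos (h.alpha_mem n) h.one_lt h.cocoercive hR hz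
        (h.extrapolation n ω) (h.backward n ω)
      simp only [← h.update] at hb
      refine (integral_mono ((hint (hξ2 (n + 1))).add (hθi n)).integrableOn
        (((((hint (hξ2 n)).const_mul (1 + α n)).add ((hint (hd2 n)).const_mul (2 * α n))).add
          ((hes n).const_mul ‖R‖)).sub ((hYe n).const_mul (2 * lam n))).integrableOn hb).trans
        (le_of_eq ?_)
      have i1 := ((hint (hξ2 n)).const_mul (1 + α n)).integrableOn (s := S)
      have i2 := ((hint (hd2 n)).const_mul (2 * α n)).integrableOn (s := S)
      have i3 := ((hes n).const_mul ‖R‖).integrableOn (s := S)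
      have i4 := ((hYe n).const_mul (2 * lam n)).integrableOn (s := S)
      have i5 := ((integrable_condExp (m := F n) (μ := P)
        (f := fun ω' => ‖a n ω' - Q (C n ω')‖ ^ 2)).const_mul ‖R‖).integrableOn (s := S)
      -- Over an event of `F n` the squared noise and its conditional expectation have the same
      -- integral.
      refine integral_add_add_sub_eq_of_integral_eq i1 i2 i3 i4 i5 ?_ ?_
      · rw [integral_const_mul, integral_const_mul, setIntegral_condExp (F.le n) (hes n) hS]
      · rw [integral_const_mul, horth n S hS, mul_zero])
    (by
      filter_upwards [h.summable_variance, h.bddAbove_increment] with ω h1 ⟨r, hr⟩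
      refine Summable.add ?_ (h1.mul_left _)
      refine Summable.of_nonneg_of_le (fun n => mul_nonneg (mul_nonneg zero_le_two
        (h.alpha_mem n).1) (hnn _)) (fun n => ?_) (h.summable_alpha.mul_left (2 * (‖U‖ * r * r)))
      have hrn : ‖X n ω - X (n - 1) ω‖ ≤ r := hr ⟨n, rfl⟩
      have h2 : ⟪U (X n ω - X (n - 1) ω), X n ω - X (n - 1) ω⟫_ℝ ≤ ‖U‖ * r * r :=
        (real_inner_le_norm _ _).trans (mul_le_mul (U.le_opNorm_of_le hrn) hrn (norm_nonneg _)
          (mul_nonneg (norm_nonneg _) ((norm_nonneg _).trans hrn)))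
      have := mul_le_mul_of_nonneg_left h2 (h.alpha_mem n).1
      linarith)
  have hnoise := ae_summable_of_summable_condExp hes (fun _ _ => by positivity) h.summable_variance
  filter_upwards [hRS, hnoise] with ω ⟨h1, h2⟩ h3
  have he0 : Tendsto (fun n => a n ω - Q (C n ω)) atTop (𝓝 0) := by
    have := h3.tendsto_atTop_zero.sqrt
    simp only [Real.sqrt_sq (norm_nonneg _), Real.sqrt_zero] at this
    exact tendsto_zero_iff_norm_tendsto_zero.2 this
  have h4 := h2.tendsto_atTop_zero.div_const ε
  simp only [mul_div_cancel_left₀ _ h.eps_pos.ne', zero_div] at h4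
  have hβ : 0 < 2 * β - 1 := by linarith [h.one_lt]
  have hg0 : Tendsto (fun n => R (Q (C n ω) - Q z)) atTop (𝓝 0) := by
    refine h.stronglyPositive.tendsto_zero ?_
    have h5 := h4.div_const (2 * β - 1)
    rw [zero_div] at h5
    refine squeeze_zero (fun n => hnn _) (fun n => ?_) h5
    rw [le_div_iff₀ hβ, mul_comm]
    exact le_add_of_nonneg_right (hnn _)
  have hr0 : Tendsto (fun n => C n ω - T n ω - R (Q (C n ω) - Q z) - R (a n ω - Q (C n ω))) atTop
      (𝓝 0) := by
    refine h.stronglyPositive.tendsto_zero (squeeze_zero (fun n => hnn _) (fun n => ?_) h4)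
    exact le_add_of_nonneg_left (mul_nonneg hβ.le (hnn _))
  refine ⟨h1, ?_, he0, ?_⟩
  -- Applying U undoes R and returns the forward difference itself.
  · have := (U.continuous.tendsto 0).comp hg0
    simp only [Function.comp_def, hR, map_zero] at this
    exact tendsto_sub_nhds_zero_iff.1 this
  · have := (hr0.add hg0).add ((R.continuous.tendsto 0).comp he0)
    simp only [Function.comp_def, map_zero, add_zero] at this
    refine this.congr fun n => ?_
    abel

/-- Almost sure weak convergence of the inertial stochastic forward-backward iteration. -/
theorem exists_weak_limit (hMcl : ∀ (t w : ℕ → H) (t0 w0 : H), (∀ n, w n ∈ M (t n)) →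
      WeaklyTendsto t t0 → Tendsto w atTop (𝓝 w0) → w0 ∈ M t0)
    (hzer : ∃ z, -Q z ∈ M z) :
    ∃ Xbar : Ω → H, Measurable Xbar ∧ ∀ᵐ ω ∂P, -Q (Xbar ω) ∈ M (Xbar ω) ∧
      WeaklyTendsto (fun n => X n ω) (Xbar ω) ∧
      Tendsto (fun n => C n ω - X n ω) atTop (𝓝 0) ∧
      Tendsto (fun n => Q (C n ω)) atTop (𝓝 (Q (Xbar ω))) := by
  obtain ⟨κ, hκ, hQ⟩ := exists_cocoercive h.stronglyPositive
    (show 0 < β by linarith [h.one_lt]) h.cocoercive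
  obtain ⟨z₀, hz₀⟩ := hzer
  let S : Set H := {z | -Q z ∈ M z}
  -- The exceptional null set depends on the zero; a countable dense set of zeros leaves a single
  -- null set.
  obtain ⟨D, hDS, hDc, hDd⟩ :=
    (TopologicalSpace.IsSeparable.of_separableSpace S).exists_countable_dense_subset
  have hinertia : ∀ᵐ ω ∂P, Tendsto (fun n => C n ω - X n ω) atTop (𝓝 0) := by
    filter_upwards [h.bddAbove_increment] with ω ⟨r, hr⟩
    have h1 : Tendsto (fun n => α n * r) atTop (𝓝 0) := by
      simpa using h.summable_alpha.tendsto_atTop_zero.mul_const r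
    refine squeeze_zero_norm (fun n => ?_) h1
    rw [h.extrapolation, add_sub_cancel_left, norm_smul, Real.norm_of_nonneg (h.alpha_mem n).1]
    exact mul_le_mul_of_nonneg_left (hr ⟨n, rfl⟩) (h.alpha_mem n).1
  have hall : ∀ᵐ ω ∂P, ∀ z ∈ D,
      ∃ l, Tendsto (fun n => ⟪U (X n ω - z), X n ω - z⟫_ℝ) atTop (𝓝 l) :=
    (ae_ball_iff hDc).2 fun z hz => (h.ae_tendsto_of_zero (hDS hz)).mono fun _ hω => hω.1
  have hDne : D.Nonempty := closure_nonempty_iff.1 ⟨z₀, hDd hz₀⟩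
  have key : ∀ᵐ ω ∂P, ∃ l ∈ S, WeaklyTendsto (fun n => X n ω) l ∧
      Tendsto (fun n => Q (C n ω)) atTop (𝓝 (Q l)) := by
    filter_upwards [hall, h.ae_tendsto_of_zero hz₀, hinertia] with ω hω ⟨_, hQz, he, hCT⟩ hCX
    -- Cocoercivity between `C (φ n) ω` and l passes to the limit: the inner product pairs a weakly
    -- null factor with a strongly convergent one, leaving κ ‖Q z₀ - Q l‖² ≤ 0.
    have hQl : ∀ (φ : ℕ → ℕ) (l : H), Tendsto φ atTop atTop →
        WeaklyTendsto (fun n => X (φ n) ω) l → Q l = Q z₀ := by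
      intro φ l hφ hl
      have h1 : WeaklyTendsto (fun n => C (φ n) ω - l) 0 := by
        have := ((WeaklyTendsto.of_tendsto (hCX.comp hφ)).add hl).sub
          (WeaklyTendsto.of_tendsto (tendsto_const_nhds (x := l)))
        simpa using this
      have h2 : Tendsto (fun n => Q (C (φ n) ω) - Q l) atTop (𝓝 (Q z₀ - Q l)) :=
        (hQz.comp hφ).sub tendsto_const_nhds
      have h3 := h1.inner_tendsto h2
      rw [inner_zero_left] at h3
      have h4 := le_of_tendsto_of_tendsto' ((h2.norm.pow 2).const_mul κ) h3 fun n => hQ _ _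
      have h5 : ‖Q z₀ - Q l‖ ^ 2 ≤ 0 := nonpos_of_mul_nonpos_right h4 hκ
      exact (sub_eq_zero.1 (norm_eq_zero.1 (pow_eq_zero_iff two_ne_zero |>.1
        (le_antisymm h5 (sq_nonneg _))))).symm
    obtain ⟨l, hlS, hl⟩ := exists_weaklyTendsto_of_opial h.isSelfAdjoint h.stronglyPositive hDd
      hDne hω fun φ l hφ hl => by
        have hφ' := hφ.tendsto_atTop
        -- The backward points share the weak limit l, and the attached elements of M converge
        -- strongly to -Q z₀ = -Q l.
        refine hMcl (fun n => T (φ n) ω) (fun n => U (C (φ n) ω - T (φ n) ω) - a (φ n) ω) l _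
          (fun n => h.backward _ _) ?_ ?_
        · have := (hl.add (WeaklyTendsto.of_tendsto (hCX.comp hφ'))).sub
            (WeaklyTendsto.of_tendsto (hCT.comp hφ'))
          simpa using this
        · have h1 := ((U.continuous.tendsto 0).comp (hCT.comp hφ')).sub
            ((he.add hQz).comp hφ')
          rw [hQl φ l hφ' hl]
          simpa [Function.comp_def] using h1
    refine ⟨l, hlS, hl, ?_⟩
    rw [hQl id l tendsto_id hl]
    exact hQz
  obtain ⟨Xbar, hXm, hXw⟩ := exists_measurable_weaklyTendsto
    (fun n => (h.adapted n).mono (F.le n) le_rfl) (key.mono fun ω ⟨l, hl⟩ => ⟨l, hl.2.1⟩)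
  refine ⟨Xbar, hXm, ?_⟩
  filter_upwards [hXw, key, hinertia] with ω h1 ⟨l, hlS, hl, hQl⟩ h3
  obtain rfl := hl.unique h1
  exact ⟨hlS, h1, h3, hQl⟩

end IsStochasticForwardBackward

end StochasticForwardBackward

/-! ### The primal-dual inclusion on the product space. -/

section PrimalDualPair

variable {E F : Type*} [NormedAddCommGroup E] [InnerProductSpace ℝ E]
  [NormedAddCommGroup F] [InnerProductSpace ℝ F]

/-- Adjoining (x, u) to the graph keeps it monotone, so by maximality it was there already. -/
theorem MaximallyMonotone.mem_of_forall {A : E → Set E} (hA : MaximallyMonotone A) {x u : E}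
    (h : ∀ y w, w ∈ A y → 0 ≤ ⟪x - y, u - w⟫_ℝ) : u ∈ A x := by
  let A' : E → Set E := fun y => A y ∪ {w | y = x ∧ w = u}
  have hA' : MonotoneOp A' := by
    rintro y y' w w' (hw | ⟨rfl, rfl⟩) (hw' | ⟨rfl, rfl⟩)
    · exact hA.1 _ _ _ _ hw hw'
    · have := h _ _ hw
      rwa [← neg_sub y, ← neg_sub w, inner_neg_neg] at this
    · exact h _ _ hw'
    · simp
  rw [← hA.2 A' hA' fun y => Set.subset_union_left]
  exact Or.inr ⟨rfl, rfl⟩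

/-- The block diagonal operator on the Hilbert direct sum of two spaces. -/
noncomputable def prodOp (S : E →L[ℝ] E) (T : F →L[ℝ] F) :
    WithLp 2 (E × F) →L[ℝ] WithLp 2 (E × F) :=
  (WithLp.prodContinuousLinearEquiv 2 ℝ E F).symm.toContinuousLinearMap ∘L
    (S.prodMap T) ∘L (WithLp.prodContinuousLinearEquiv 2 ℝ E F).toContinuousLinearMap

@[simp] theorem prodOp_fst (S : E →L[ℝ] E) (T : F →L[ℝ] F) (x : WithLp 2 (E × F)) :
    (prodOp S T x).fst = S x.fst := rfl

@[simp] theorem prodOp_snd (S : E →L[ℝ] E) (T : F →L[ℝ] F) (x : WithLp 2 (E × F)) :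
    (prodOp S T x).snd = T x.snd := rfl

theorem inner_prod_eq (x y : WithLp 2 (E × F)) :
    ⟪x, y⟫_ℝ = ⟪x.fst, y.fst⟫_ℝ + ⟪x.snd, y.snd⟫_ℝ := rfl

theorem StronglyPositive.prodOp {S : E →L[ℝ] E} {T : F →L[ℝ] F} (hS : StronglyPositive S)
    (hT : StronglyPositive T) : StronglyPositive (prodOp S T) := by
  obtain ⟨χ, hχ, h⟩ := hS
  obtain ⟨χ', hχ', h'⟩ := hT
  refine ⟨min χ χ', lt_min hχ hχ', fun x => ?_⟩
  rw [WithLp.prod_norm_sq_eq_of_L2, inner_prod_eq, mul_add]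
  exact add_le_add
    ((mul_le_mul_of_nonneg_right (min_le_left _ _) (sq_nonneg _)).trans (h _))
    ((mul_le_mul_of_nonneg_right (min_le_right _ _) (sq_nonneg _)).trans (h' _))

variable [CompleteSpace E] [CompleteSpace F]

theorem IsSelfAdjoint.prodOp {S : E →L[ℝ] E} {T : F →L[ℝ] F} (hS : IsSelfAdjoint S)
    (hT : IsSelfAdjoint T) : IsSelfAdjoint (prodOp S T) := by
  rw [ContinuousLinearMap.isSelfAdjoint_iff_isSymmetric]
  intro x y
  have h1 : ⟪S x.fst, y.fst⟫_ℝ = ⟪x.fst, S y.fst⟫_ℝ := hS.isSymmetric _ _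
  have h2 : ⟪T x.snd, y.snd⟫_ℝ = ⟪x.snd, T y.snd⟫_ℝ := hT.isSymmetric _ _
  simp only [ContinuousLinearMap.coe_coe, inner_prod_eq, prodOp_fst, prodOp_snd, h1, h2]

theorem isSelfAdjoint_of_rightInverse {U R : E →L[ℝ] E} (hU : IsSelfAdjoint U)
    (hR : ∀ x, U (R x) = x) : IsSelfAdjoint R := by
  rw [ContinuousLinearMap.isSelfAdjoint_iff_isSymmetric]
  intro x y
  have h := hU.isSymmetric (R x) (R y)
  simp only [ContinuousLinearMap.coe_coe, hR] at h ⊢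
  exact h.symm

-- With x = U (R x), the form of R at x is that of U at R x, and ‖x‖ ≤ ‖U‖ ‖R x‖.
omit [CompleteSpace E] in
theorem StronglyPositive.of_rightInverse {U R : E →L[ℝ] E} (hU : StronglyPositive U)
    (hR : ∀ x, U (R x) = x) : StronglyPositive R := by
  obtain ⟨χ, hχ, h⟩ := hU
  refine ⟨χ / (‖U‖ ^ 2 + 1), by positivity, fun x => ?_⟩
  have h1 := h (R x)
  rw [hR, real_inner_comm] at h1
  refine le_trans ?_ h1
  rw [div_mul_eq_mul_div, div_le_iff₀ (by positivity), mul_assoc]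
  refine mul_le_mul_of_nonneg_left ?_ hχ.le
  have h2 := pow_le_pow_left₀ (norm_nonneg _) (U.le_opNorm (R x)) 2
  rw [hR] at h2
  nlinarith [sq_nonneg ‖R x‖]

theorem opSqrt_spec {T : E →L[ℝ] E} (hT : IsSelfAdjoint T) (hp : StronglyPositive T) :
    IsSelfAdjoint (opSqrt T) ∧ ∀ x, opSqrt T (opSqrt T x) = T x := by
  have h := exists_isPositive_mul_self hT hp
  have e : opSqrt T = h.choose := dif_pos h
  rw [e]
  exact ⟨h.choose_spec.1.isSelfAdjoint, fun x => DFunLike.congr_fun h.choose_spec.2 x⟩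

/-! ### The Schur complement metric. -/

section Metric

variable {V : E →L[ℝ] E} {W R : F →L[ℝ] F} {L : E →L[ℝ] F}

/-- The lower bound of the Schur complement `W⁻¹ - L V L^*` and the dual upper bound of its
inverse. -/
theorem schur_bounds (hV : IsSelfAdjoint V) (hVp : StronglyPositive V) (hW : IsSelfAdjoint W)
    (hWp : StronglyPositive W) (hR : ∀ x, W (R x) = x)
    (hκ : 0 < 1 - ‖opSqrt W ∘L L ∘L opSqrt V‖ ^ 2) (h : F) :
    (1 - ‖opSqrt W ∘L L ∘L opSqrt V‖ ^ 2) * ⟪R h, h⟫_ℝ ≤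
        ⟪(R - L ∘L V ∘L L.adjoint) h, h⟫_ℝ ∧
      (1 - ‖opSqrt W ∘L L ∘L opSqrt V‖ ^ 2) * ⟪(R - L ∘L V ∘L L.adjoint) h, h⟫_ℝ ≤
        ⟪W ((R - L ∘L V ∘L L.adjoint) h), (R - L ∘L V ∘L L.adjoint) h⟫_ℝ := by
  obtain ⟨hv, hvv⟩ := opSqrt_spec hV hVp
  obtain ⟨hw, hww⟩ := opSqrt_spec hW hWp
  have hvs : ∀ x y, ⟪opSqrt V x, y⟫_ℝ = ⟪x, opSqrt V y⟫_ℝ := hv.isSymmetric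
  have hws : ∀ x y, ⟪opSqrt W x, y⟫_ℝ = ⟪x, opSqrt W y⟫_ℝ := hw.isSymmetric
  set N := opSqrt W ∘L L ∘L opSqrt V with hN
  -- In this variable h = √W k, so ⟪R h, h⟫ = ‖k‖² and ⟪L V L^* h, h⟫ = ‖N^* k‖².
  set k := opSqrt W (R h) with hk
  have hkh : opSqrt W k = h := by rw [hk, hww, hR]
  have h1 : ⟪R h, h⟫_ℝ = ‖k‖ ^ 2 := by
    conv_lhs => rw [← hkh]
    rw [← hws, hk, hkh, real_inner_self_eq_norm_sq]
  have h2 : ⟪(L ∘L V ∘L L.adjoint) h, h⟫_ℝ ≤ ‖N‖ ^ 2 * ‖k‖ ^ 2 := by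
    have e1 : ⟪(L ∘L V ∘L L.adjoint) h, h⟫_ℝ = ‖N.adjoint k‖ ^ 2 := by
      have e2 : N.adjoint k = opSqrt V (L.adjoint h) := by
        rw [hN, ContinuousLinearMap.adjoint_comp, ContinuousLinearMap.adjoint_comp,
          hw.adjoint_eq, hv.adjoint_eq]
        simp [hkh]
      rw [e2, ← real_inner_self_eq_norm_sq, hvs, hvv,
        ContinuousLinearMap.adjoint_inner_left, real_inner_comm]
      rfl
    rw [e1, ← mul_pow]
    have := N.adjoint.le_opNorm k
    rw [LinearIsometryEquiv.norm_map] at this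
    exact pow_le_pow_left₀ (norm_nonneg _) this 2
  have h3 : (1 - ‖N‖ ^ 2) * ‖k‖ ^ 2 ≤ ⟪(R - L ∘L V ∘L L.adjoint) h, h⟫_ℝ := by
    rw [sub_apply, inner_sub_left, h1]
    linarith
  refine ⟨by rwa [h1], ?_⟩
  set g := (R - L ∘L V ∘L L.adjoint) h with hg
  have h4 : ⟪g, h⟫_ℝ ≤ ‖k‖ * ‖opSqrt W g‖ := by
    conv_lhs => rw [← hkh]
    rw [← hws, mul_comm]
    exact real_inner_le_norm _ _
  have h5 : ⟪W g, g⟫_ℝ = ‖opSqrt W g‖ ^ 2 := by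
    rw [← hww, hws, real_inner_self_eq_norm_sq]
  rw [h5]
  -- Compare `h3` with the Cauchy–Schwarz bound `h4` and cancel ‖k‖.
  have h6 : (1 - ‖N‖ ^ 2) * ‖k‖ ≤ ‖opSqrt W g‖ := by
    rcases (norm_nonneg k).eq_or_lt with h0 | h0
    · rw [← h0, mul_zero]
      exact norm_nonneg _
    · refine le_of_mul_le_mul_right ?_ h0
      linarith
  calc (1 - ‖N‖ ^ 2) * ⟪g, h⟫_ℝ ≤ (1 - ‖N‖ ^ 2) * (‖k‖ * ‖opSqrt W g‖) :=
        mul_le_mul_of_nonneg_left h4 hκ.le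
    _ = ((1 - ‖N‖ ^ 2) * ‖k‖) * ‖opSqrt W g‖ := by ring
    _ ≤ ‖opSqrt W g‖ * ‖opSqrt W g‖ := mul_le_mul_of_nonneg_right h6 (norm_nonneg _)
    _ = _ := by ring

theorem stronglyPositive_schur (hV : IsSelfAdjoint V) (hVp : StronglyPositive V)
    (hW : IsSelfAdjoint W) (hWp : StronglyPositive W) (hR : ∀ x, W (R x) = x)
    (hκ : 0 < 1 - ‖opSqrt W ∘L L ∘L opSqrt V‖ ^ 2) :
    StronglyPositive (R - L ∘L V ∘L L.adjoint) := by
  obtain ⟨χ, hχ, h⟩ := hWp.of_rightInverse hR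
  refine ⟨_, mul_pos hκ hχ, fun x => ?_⟩
  rw [mul_assoc]
  exact (mul_le_mul_of_nonneg_left (h x) hκ.le).trans (schur_bounds hV hVp hW hWp hR hκ x).1

theorem isSelfAdjoint_schur (hV : IsSelfAdjoint V) (hR : IsSelfAdjoint R) :
    IsSelfAdjoint (R - L ∘L V ∘L L.adjoint) :=
  hR.sub (hV.conj_adjoint L)

/-- Cocoercivity of the pair of single-valued operators in the primal-dual metric. -/
theorem primalDual_cocoercive {R' : E →L[ℝ] E} (hV : IsSelfAdjoint V) (hVp : StronglyPositive V)
    (hR' : ∀ x, V (R' x) = x) (hW : IsSelfAdjoint W) (hWp : StronglyPositive W)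
    (hR : ∀ x, W (R x) = x) {ν μ β : ℝ} (hμ : 0 < μ) (hβ : 0 < β) (hβν : β ≤ ν)
    (hβμ : β ≤ μ * (1 - ‖opSqrt W ∘L L ∘L opSqrt V‖ ^ 2))
    {C : E → E} (hC : ∀ x y, ν * ⟪V (C x - C y), C x - C y⟫_ℝ ≤ ⟪x - y, C x - C y⟫_ℝ)
    {D : F → F} (hD : ∀ x y, μ * ⟪W (D x - D y), D x - D y⟫_ℝ ≤ ⟪x - y, D x - D y⟫_ℝ)
    (x y h : WithLp 2 (E × F))
    (hh : prodOp R' (R - L ∘L V ∘L L.adjoint) h =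
      WithLp.toLp 2 (C x.fst, D x.snd) - WithLp.toLp 2 (C y.fst, D y.snd)) :
    β * ⟪prodOp R' (R - L ∘L V ∘L L.adjoint) h, h⟫_ℝ ≤
      ⟪x - y, WithLp.toLp 2 (C x.fst, D x.snd) - WithLp.toLp 2 (C y.fst, D y.snd)⟫_ℝ := by
  have hκ : 0 < 1 - ‖opSqrt W ∘L L ∘L opSqrt V‖ ^ 2 :=
    pos_of_mul_pos_right (hβ.trans_le hβμ) hμ.le
  have h1 : R' h.fst = C x.fst - C y.fst := congrArg WithLp.fst hh
  have h2 : (R - L ∘L V ∘L L.adjoint) h.snd = D x.snd - D y.snd := congrArg WithLp.snd hh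
  have h3 : β * ⟪R' h.fst, h.fst⟫_ℝ ≤ ⟪x.fst - y.fst, C x.fst - C y.fst⟫_ℝ := by
    refine le_trans ?_ (hC _ _)
    rw [← h1, hR', real_inner_comm]
    refine mul_le_mul_of_nonneg_right hβν ?_
    have := hVp.inner_nonneg (R' h.fst)
    rwa [hR'] at this
  -- The dual cocoercivity constant μ loses the factor 1 - ‖√W L √V‖² here, through the second Schur
  -- bound; the primal component loses nothing.
  have h4 : β * ⟪(R - L ∘L V ∘L L.adjoint) h.snd, h.snd⟫_ℝ ≤
      ⟪x.snd - y.snd, D x.snd - D y.snd⟫_ℝ := by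
    refine le_trans ?_ (hD _ _)
    have h5 := (schur_bounds hV hVp hW hWp hR hκ h.snd).2
    have h6 := (stronglyPositive_schur (L := L) hV hVp hW hWp hR hκ).inner_nonneg h.snd
    rw [← h2]
    calc _ ≤ μ * (1 - ‖opSqrt W ∘L L ∘L opSqrt V‖ ^ 2) *
          ⟪(R - L ∘L V ∘L L.adjoint) h.snd, h.snd⟫_ℝ := mul_le_mul_of_nonneg_right hβμ h6
      _ ≤ _ := by
        rw [mul_assoc]
        exact mul_le_mul_of_nonneg_left h5 hμ.le
  rw [inner_prod_eq, inner_prod_eq, prodOp_fst, prodOp_snd, mul_add]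
  exact add_le_add h3 h4

end Metric

/-- The set-valued part `(x, v) ↦ (-z + L^* v, r + A v - L x)` of the primal-dual inclusion. -/
def primalDualOp (z : E) (r : F) (L : E →L[ℝ] F) (A : F → Set F) :
    WithLp 2 (E × F) → Set (WithLp 2 (E × F)) := fun t =>
  {w | w.fst = L.adjoint t.snd - z ∧ w.snd + L t.fst - r ∈ A t.snd}

/-- The coupling (x, v) ↦ (L^* v, -L x) is skew and contributes nothing; only A remains. -/
theorem monotoneOp_primalDualOp {z : E} {r : F} {L : E →L[ℝ] F} {A : F → Set F}
    (hA : MonotoneOp A) : MonotoneOp (primalDualOp z r L A) := by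
  rintro x y u w ⟨hu1, hu2⟩ ⟨hw1, hw2⟩
  have h := hA _ _ _ _ hu2 hw2
  have e : ⟪x - y, u - w⟫_ℝ =
      ⟪x.snd - y.snd, u.snd + L x.fst - r - (w.snd + L y.fst - r)⟫_ℝ := by
    have e1 : u.snd + L x.fst - r - (w.snd + L y.fst - r) =
        (u.snd - w.snd) + L (x.fst - y.fst) := by
      rw [map_sub]
      abel
    have e2 : u.fst - w.fst = L.adjoint (x.snd - y.snd) := by
      rw [hu1, hw1, map_sub]
      abel
    rw [inner_prod_eq, e1, inner_add_right, WithLp.sub_fst, WithLp.sub_fst, WithLp.sub_snd,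
      WithLp.sub_snd, e2, ContinuousLinearMap.adjoint_inner_right,
      real_inner_comm (L _), add_comm]
  rwa [e]

theorem WeaklyTendsto.fst {t : ℕ → WithLp 2 (E × F)} {t0 : WithLp 2 (E × F)}
    (h : WeaklyTendsto t t0) : WeaklyTendsto (fun n => (t n).fst) t0.fst :=
  h.map (WithLp.fstL 2 ℝ E F)

theorem WeaklyTendsto.snd {t : ℕ → WithLp 2 (E × F)} {t0 : WithLp 2 (E × F)}
    (h : WeaklyTendsto t t0) : WeaklyTendsto (fun n => (t n).snd) t0.snd :=
  h.map (WithLp.sndL 2 ℝ E F)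

/-- The graph of the set-valued part is closed for the weak topology on the domain and the strong
topology on the range. -/
theorem mem_primalDualOp_of_tendsto {z : E} {r : F} {L : E →L[ℝ] F} {A : F → Set F}
    (hA : MonotoneOp A)
    (hmax : ∀ v u, (∀ v' u', u' ∈ A v' → 0 ≤ ⟪v - v', u - u'⟫_ℝ) → u ∈ A v)
    (t w : ℕ → WithLp 2 (E × F)) (t0 w0 : WithLp 2 (E × F))
    (hmem : ∀ n, w n ∈ primalDualOp z r L A (t n))
    (ht : WeaklyTendsto t t0) (hw : Tendsto w atTop (𝓝 w0)) : w0 ∈ primalDualOp z r L A t0 := by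
  have hw1 : Tendsto (fun n => (w n).fst) atTop (𝓝 w0.fst) :=
    ((WithLp.fstL 2 ℝ E F).continuous.tendsto w0).comp hw
  have hw2 : Tendsto (fun n => (w n).snd) atTop (𝓝 w0.snd) :=
    ((WithLp.sndL 2 ℝ E F).continuous.tendsto w0).comp hw
  -- The first graph equation turns strong convergence of w into strong convergence of L^* v_n,
  -- although v_n itself converges only weakly.
  have hadj : Tendsto (fun n => L.adjoint (t n).snd) atTop (𝓝 (w0.fst + z)) := by
    refine (hw1.add_const z).congr fun n => ?_
    rw [(hmem n).1, sub_add_cancel]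
  have e : w0.fst + z = L.adjoint t0.snd :=
    (WeaklyTendsto.of_tendsto hadj).unique (ht.snd.map L.adjoint)
  refine ⟨eq_sub_of_add_eq e, hmax _ _ fun v' u' hu' => ?_⟩
  rw [e] at hadj
  have h1 : Tendsto (fun n => ⟪(t n).snd - v', (w n).snd - r - u'⟫_ℝ) atTop
      (𝓝 ⟪t0.snd - v', w0.snd - r - u'⟫_ℝ) :=
    (ht.snd.sub (.of_tendsto tendsto_const_nhds)).inner_tendsto
      ((hw2.sub_const r).sub_const u')
  have h2 : Tendsto (fun n => ⟪(t n).fst, L.adjoint (t n).snd - L.adjoint v'⟫_ℝ) atTop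
      (𝓝 ⟪t0.fst, L.adjoint t0.snd - L.adjoint v'⟫_ℝ) :=
    ht.fst.inner_tendsto (hadj.sub_const _)
  -- Moving L to the other side replaces a weak-weak pairing of v with L x by a weak-strong pairing
  -- of x with L^* v.
  have key : ∀ (x : E) (v b : F), ⟪v - v', b - r - u'⟫_ℝ + ⟪x, L.adjoint v - L.adjoint v'⟫_ℝ =
      ⟪v - v', b + L x - r - u'⟫_ℝ := by
    intro x v b
    have e1 : b + L x - r - u' = (b - r - u') + L x := by abel
    rw [← map_sub, ContinuousLinearMap.adjoint_inner_right, e1, inner_add_right,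
      real_inner_comm (L x)]
  rw [← key]
  refine ge_of_tendsto' (h1.add h2) fun n => ?_
  rw [key]
  exact hA _ _ _ _ (hmem n).2 hu'

end PrimalDualPair

/-! ### Measurability and integrability through Lipschitz dependence. -/

section LipschitzFactor

variable {Ω E F : Type*} [MeasurableSpace Ω] [NormedAddCommGroup E] [NormedAddCommGroup F]
  {u : Ω → E} {f : Ω → F} {K : ℝ}

/-- A function that is Lipschitz relative to a measurable function is measurable. -/
theorem measurable_of_norm_sub_le [MeasurableSpace E] [BorelSpace E] [MeasurableSpace F]
    [BorelSpace F] (hf : ∀ ω ω', ‖f ω - f ω'‖ ≤ K * ‖u ω - u ω'‖) (hu : Measurable u) :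
    Measurable f := by
  -- Equal values of u force equal values of f, so f factors through the range of u and the choice
  -- is immaterial.
  let g : Set.range u → F := fun y => f y.2.choose
  have hg : ∀ ω, g ⟨u ω, ω, rfl⟩ = f ω := fun ω => by
    have hω : u (Exists.choose (⟨ω, rfl⟩ : u ω ∈ Set.range u)) = u ω :=
      Exists.choose_spec (⟨ω, rfl⟩ : u ω ∈ Set.range u)
    have := hf (Exists.choose (⟨ω, rfl⟩ : u ω ∈ Set.range u)) ω
    rw [hω, sub_self, norm_zero, mul_zero] at this
    exact sub_eq_zero.1 (norm_le_zero_iff.1 this)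
  have hgc : LipschitzWith K.toNNReal g := by
    refine LipschitzWith.of_dist_le_mul fun y y' => ?_
    obtain ⟨_, ω, rfl⟩ := y
    obtain ⟨_, ω', rfl⟩ := y'
    rw [hg, hg, dist_eq_norm, Subtype.dist_eq, dist_eq_norm]
    exact (hf ω ω').trans (mul_le_mul_of_nonneg_right (Real.le_coe_toNNReal K) (norm_nonneg _))
  have e : f = fun ω => g ⟨u ω, ω, rfl⟩ := funext fun ω => (hg ω).symm
  rw [e]
  exact hgc.continuous.measurable.comp (hu.subtype_mk)

theorem memLp_of_norm_sub_le {P : Measure Ω} [IsFiniteMeasure P] {p : ENNReal} [Nonempty Ω]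
    (hf : ∀ ω ω', ‖f ω - f ω'‖ ≤ K * ‖u ω - u ω'‖) (hfm : AEStronglyMeasurable f P)
    (hu : MemLp u p P) : MemLp f p P := by
  obtain ⟨ω₀⟩ := ‹Nonempty Ω›
  have h1 : MemLp (fun ω => f ω - f ω₀) p P :=
    MemLp.of_le_mul (c := K) (hu.sub (memLp_const (u ω₀))) (hfm.sub aestronglyMeasurable_const)
      (ae_of_all _ fun ω => hf ω ω₀)
  exact (h1.add (memLp_const (f ω₀))).congr_norm hfm (ae_of_all _ fun ω => by simp)

end LipschitzFactor

/-- The points `q` with `W⁻¹ (u - q) ∈ A q` depend on `u` in a Lipschitz manner when `A` is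
monotone. -/
theorem norm_resolvent_sub_le {F : Type*} [NormedAddCommGroup F] [InnerProductSpace ℝ F]
    {A : F → Set F} (hA : MonotoneOp A) {R : F →L[ℝ] F} (hR : StronglyPositive R) :
    ∃ K : ℝ, ∀ u u' q q', R (u - q) ∈ A q → R (u' - q') ∈ A q' →
      ‖q - q'‖ ≤ K * ‖u - u'‖ := by
  obtain ⟨χ, hχ, h⟩ := hR
  refine ⟨‖R‖ / χ, fun u u' q q' hq hq' => ?_⟩
  have h1 := hA _ _ _ _ hq hq'
  have e : R (u - q) - R (u' - q') = R (u - u') - R (q - q') := by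
    simp only [map_sub]
    abel
  rw [e, inner_sub_right, real_inner_comm (R (q - q')), sub_nonneg] at h1
  have h2 := (h _).trans (h1.trans (real_inner_le_norm _ _))
  have h3 := mul_le_mul_of_nonneg_left (R.le_opNorm (u - u')) (norm_nonneg (q - q'))
  rcases (norm_nonneg (q - q')).eq_or_lt with h0 | h0
  · rw [← h0]
    positivity
  · rw [div_mul_eq_mul_div, le_div_iff₀ hχ]
    refine le_of_mul_le_mul_right ?_ h0
    linarith

theorem WeaklyTendsto.of_sub_tendsto_zero {H : Type*} [NormedAddCommGroup H]
    [InnerProductSpace ℝ H] [CompleteSpace H] {u w : ℕ → H} {l : H} (h : WeaklyTendsto w l)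
    (huw : Tendsto (fun n => u n - w n) atTop (𝓝 0)) : WeaklyTendsto u l := by
  simpa using (WeaklyTendsto.of_tendsto huw).add h

/-- Demiregularity upgrades weak to strong convergence of `w`, tested along a sequence `u` that is
asymptotic to `w`. -/
theorem DemiregularAt.tendsto_of_weaklyTendsto {H : Type*} [NormedAddCommGroup H]
    [InnerProductSpace ℝ H] [CompleteSpace H] {f : H → H} {u w : ℕ → H} {l : H}
    (hf : DemiregularAt (singleValued f) l) (h : WeaklyTendsto w l)
    (huw : Tendsto (fun n => u n - w n) atTop (𝓝 0))
    (hfu : Tendsto (fun n => f (u n)) atTop (𝓝 (f l))) : Tendsto w atTop (𝓝 l) := by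
  have h1 := hf.2 u _ _ (fun n => rfl) rfl (h.of_sub_tendsto_zero huw) hfu
  simpa using h1.sub huw

/-! ### Passage from coordinates to the Hilbert direct sums. -/

section ProductSpaces

variable {m s : ℕ}
  {K : Fin m → Type*} [∀ i, NormedAddCommGroup (K i)] [∀ i, InnerProductSpace ℝ (K i)]
  {G : Fin s → Type*} [∀ k, NormedAddCommGroup (G k)] [∀ k, InnerProductSpace ℝ (G k)]

theorem StronglyPositive.diagOp {V : ∀ i, K i →L[ℝ] K i} (hV : ∀ i, StronglyPositive (V i)) :
    StronglyPositive (diagOp V) := by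
  choose χ hχ h using hV
  obtain ⟨c, hc, hcχ⟩ : ∃ c : ℝ, 0 < c ∧ ∀ i, c ≤ χ i := by
    rcases isEmpty_or_nonempty (Fin m) with h | h
    · exact ⟨1, one_pos, fun i => h.elim i⟩
    · obtain ⟨i₀, hi₀⟩ := Finite.exists_min χ
      exact ⟨χ i₀, hχ i₀, hi₀⟩
  refine ⟨c, hc, fun x => ?_⟩
  rw [PiLp.norm_sq_eq_of_L2, PiLp.inner_apply, Finset.mul_sum]
  exact Finset.sum_le_sum fun i _ =>
    (mul_le_mul_of_nonneg_right (hcχ i) (sq_nonneg _)).trans (h i _)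

theorem IsSelfAdjoint.diagOp [∀ i, CompleteSpace (K i)] {V : ∀ i, K i →L[ℝ] K i}
    (hV : ∀ i, IsSelfAdjoint (V i)) : IsSelfAdjoint (diagOp V) := by
  rw [ContinuousLinearMap.isSelfAdjoint_iff_isSymmetric]
  intro x y
  simp only [ContinuousLinearMap.coe_coe, PiLp.inner_apply, diagOp_apply]
  exact Finset.sum_congr rfl fun i _ => (hV i).isSymmetric _ _

theorem adjoint_blockOp_apply [∀ i, CompleteSpace (K i)] [∀ k, CompleteSpace (G k)]
    (L : ∀ k i, K i →L[ℝ] G k) (v : PiLp 2 G) (i : Fin m) :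
    (blockOp L).adjoint v i = ∑ k, (L k i).adjoint (v k) := by
  have h : blockOp (fun i k => (L k i).adjoint) = (blockOp L).adjoint := by
    rw [ContinuousLinearMap.eq_adjoint_iff]
    intro v x
    simp only [PiLp.inner_apply, blockOp_apply, sum_inner, inner_sum,
      ContinuousLinearMap.adjoint_inner_left]
    exact Finset.sum_comm
  rw [← h, blockOp_apply]

theorem WeaklyTendsto.apply [∀ i, CompleteSpace (K i)] {u : ℕ → PiLp 2 K} {l : PiLp 2 K}
    (h : WeaklyTendsto u l) (i : Fin m) : WeaklyTendsto (fun n => u n i) (l i) :=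
  h.map (PiLp.proj 2 K i)

omit [∀ i, InnerProductSpace ℝ (K i)] in
theorem PiLp.bddAbove_range_norm (u : ℕ → PiLp 2 K)
    (hu : ∀ i, BddAbove (Set.range fun n => ‖u n i‖)) : BddAbove (Set.range fun n => ‖u n‖) := by
  choose M hM using hu
  refine ⟨√(∑ i, M i ^ 2), ?_⟩
  rintro _ ⟨n, rfl⟩
  refine Real.le_sqrt_of_sq_le ?_
  rw [PiLp.norm_sq_eq_of_L2]
  exact Finset.sum_le_sum fun i _ => pow_le_pow_left₀ (norm_nonneg _) (hM i ⟨n, rfl⟩) 2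

omit [∀ i, InnerProductSpace ℝ (K i)] in
theorem PiLp.tendsto_apply {u : ℕ → PiLp 2 K} {l : PiLp 2 K} (hu : Tendsto u atTop (𝓝 l))
    (i : Fin m) : Tendsto (fun n => u n i) atTop (𝓝 (l i)) :=
  ((PiLp.continuous_apply 2 K i).tendsto l).comp hu

/-- The inverse of the product operator `v ↦ ∏ B_k v_k`. -/
def prodInverseOp (B : ∀ k, G k → Set (G k)) : PiLp 2 G → Set (PiLp 2 G) := fun v =>
  {u | ∀ k, v k ∈ B k (u k)}

theorem monotoneOp_prodInverseOp {B : ∀ k, G k → Set (G k)} (hB : ∀ k, MonotoneOp (B k)) :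
    MonotoneOp (prodInverseOp B) := by
  intro x y u w hu hw
  rw [PiLp.inner_apply]
  refine Finset.sum_nonneg fun k _ => ?_
  rw [real_inner_comm]
  exact hB k _ _ _ _ (hu k) (hw k)

/-- Each coordinate contributes its own pair, with inner product 0, if that pair is in the graph,
and otherwise a graph point witnessing strict violation. A single violation would make the sum
negative. -/
theorem mem_prodInverseOp_of_forall {B : ∀ k, G k → Set (G k)}
    (hB : ∀ k, MaximallyMonotone (B k)) (v u : PiLp 2 G)
    (h : ∀ v' u', u' ∈ prodInverseOp B v' → 0 ≤ ⟪v - v', u - u'⟫_ℝ) :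
    u ∈ prodInverseOp B v := by
  have hex : ∀ k, ∃ u' v', v' ∈ B k u' ∧ ⟪u k - u', v k - v'⟫_ℝ ≤ 0 ∧
      (v k ∉ B k (u k) → ⟪u k - u', v k - v'⟫_ℝ < 0) := by
    intro k
    by_cases hk : v k ∈ B k (u k)
    · exact ⟨u k, v k, hk, by simp, fun h => absurd hk h⟩
    · by_contra! hcon
      refine hk ((hB k).mem_of_forall fun y w hw => ?_)
      by_contra! hlt
      exact (hcon y w hw hlt.le).2.not_gt hlt
  choose u' v' hmem hle hlt using hex
  intro j
  by_contra hj
  have h1 := h (WithLp.toLp 2 v') (WithLp.toLp 2 u') hmem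
  rw [PiLp.inner_apply] at h1
  refine h1.not_gt (Finset.sum_neg' (fun k _ => ?_) ⟨j, Finset.mem_univ _, ?_⟩)
  · rw [real_inner_comm]
    exact hle k
  · rw [real_inner_comm]
    exact hlt j hj

theorem mem_resolventOp_compOp_iff {H : Type*} [NormedAddCommGroup H] [InnerProductSpace ℝ H]
    {U : H →L[ℝ] H} {A : H → Set H} {u q : H} :
    q ∈ resolventOp (compOp U A) u ↔ ∃ w ∈ A q, U w = u - q := by
  change u ∈ {q} + U '' A q ↔ _
  rw [Set.singleton_add, Set.image_image]
  exact exists_congr fun w => and_congr_right fun _ => eq_sub_iff_add_eq'.symm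

/-- The coordinatewise resolvents give the resolvent of the product operator. -/
theorem mem_prodInverseOp_of_resolventOp {B : ∀ k, G k → Set (G k)} {W : ∀ k, G k →L[ℝ] G k}
    {R : PiLp 2 G →L[ℝ] PiLp 2 G} (hR : ∀ v, R (diagOp W v) = v) {u q : PiLp 2 G}
    (h : ∀ k, q k ∈ resolventOp (compOp (W k) (inverseOp (B k))) (u k)) :
    R (u - q) ∈ prodInverseOp B q := by
  simp only [mem_resolventOp_compOp_iff] at h
  choose w hw hWw using h
  have e : u - q = diagOp W (WithLp.toLp 2 w) := PiLp.ext fun k => (hWw k).symm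
  rw [e, hR]
  exact hw

variable [∀ i, CompleteSpace (K i)] [∀ k, CompleteSpace (G k)]

/-- Zeros of the product-space inclusion in coordinates: the common form to which primal and dual
solutions both reduce. -/
theorem neg_toLp_mem_primalDualOp_iff {z : PiLp 2 K} {C : PiLp 2 K → PiLp 2 K} {r : PiLp 2 G}
    {B : ∀ k, G k → Set (G k)} {Dinv : ∀ k, G k → G k} {L : ∀ k i, K i →L[ℝ] G k}
    {x : PiLp 2 K} {v : PiLp 2 G} :
    -WithLp.toLp 2 (C x, WithLp.toLp 2 fun k => Dinv k (v k)) ∈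
        primalDualOp z r (blockOp L) (prodInverseOp B) (WithLp.toLp 2 (x, v)) ↔
      (∀ i, z i = ∑ k, (L k i).adjoint (v k) + C x i) ∧
        ∀ k, v k ∈ B k ((∑ i, L k i (x i)) - r k - Dinv k (v k)) := by
  refine and_congr ?_ (forall_congr' fun k => ?_)
  · rw [PiLp.ext_iff]
    refine forall_congr' fun i => ?_
    change -(C x i) = (blockOp L).adjoint v i - z i ↔ _
    rw [adjoint_blockOp_apply]
    constructor <;> intro h
    · rw [eq_sub_iff_add_eq] at h
      rw [← sub_eq_iff_eq_add, ← h]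
      abel
    · rw [h]
      abel
  · change v k ∈ B k (-(Dinv k (v k)) + blockOp L x k - r k) ↔ _
    rw [blockOp_apply]
    have e : -(Dinv k (v k)) + ∑ i, L k i (x i) - r k =
        (∑ i, L k i (x i)) - r k - Dinv k (v k) := by abel
    rw [e]

theorem mem_inverseOp_add_iff {H : Type*} [NormedAddCommGroup H] {A D : H → Set H} {f : H → H}
    (hf : inverseOp D = singleValued f) {u v : H} :
    u ∈ inverseOp A v + inverseOp D v ↔ v ∈ A (u - f v) := by
  rw [hf, singleValued, Set.mem_add]
  constructor
  · rintro ⟨w, hw, _, rfl, rfl⟩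
    rwa [add_sub_cancel_right]
  · exact fun h => ⟨_, h, _, rfl, sub_add_cancel _ _⟩

theorem mem_primalSolutions_iff {z : PiLp 2 K} {C : PiLp 2 K → PiLp 2 K} {r : PiLp 2 G}
    {B D : ∀ k, G k → Set (G k)} {Dinv : ∀ k, G k → G k}
    (hDinv : ∀ k, inverseOp (D k) = singleValued (Dinv k)) {L : ∀ k i, K i →L[ℝ] G k}
    {x : PiLp 2 K} :
    x ∈ primalSolutions z (fun _ _ => {0}) C r B D L ↔ ∃ v : PiLp 2 G,
      -WithLp.toLp 2 (C x, WithLp.toLp 2 fun k => Dinv k (v k)) ∈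
        primalDualOp z r (blockOp L) (prodInverseOp B) (WithLp.toLp 2 (x, v)) := by
  refine exists_congr fun v => ?_
  rw [neg_toLp_mem_primalDualOp_iff, and_comm]
  refine and_congr (forall_congr' fun i => by simp) (forall_congr' fun k => ?_)
  rw [← mem_inverseOp_add_iff (hDinv k), add_comm]
  rfl

theorem mem_dualSolutions_iff {z : PiLp 2 K} {C : PiLp 2 K → PiLp 2 K} {r : PiLp 2 G}
    {B D : ∀ k, G k → Set (G k)} {Dinv : ∀ k, G k → G k}
    (hDinv : ∀ k, inverseOp (D k) = singleValued (Dinv k)) {L : ∀ k i, K i →L[ℝ] G k}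
    {v : PiLp 2 G} :
    v ∈ dualSolutions z (fun _ _ => {0}) C r B D L ↔ ∃ x : PiLp 2 K,
      -WithLp.toLp 2 (C x, WithLp.toLp 2 fun k => Dinv k (v k)) ∈
        primalDualOp z r (blockOp L) (prodInverseOp B) (WithLp.toLp 2 (x, v)) := by
  refine exists_congr fun x => ?_
  rw [neg_toLp_mem_primalDualOp_iff]
  refine and_congr (forall_congr' fun i => ?_) (forall_congr' fun k => ?_)
  · simp [sub_eq_iff_eq_add, add_comm]
  · rw [← mem_inverseOp_add_iff (hDinv k)]

end ProductSpaces

/-- Conditional expectation commutes with the two continuous linear inclusions of the factors. -/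
theorem condExp_toLp {Ω : Type*} [MeasurableSpace Ω] {E F : Type*}
    [NormedAddCommGroup E] [InnerProductSpace ℝ E] [CompleteSpace E]
    [NormedAddCommGroup F] [InnerProductSpace ℝ F] [CompleteSpace F] {P : Measure Ω}
    {m : MeasurableSpace Ω} {f : Ω → E} {g : Ω → F}
    (hf : Integrable f P) (hg : Integrable g P) :
    P[fun ω => WithLp.toLp 2 (f ω, g ω) | m] =ᵐ[P]
      fun ω => WithLp.toLp 2 ((P[f | m]) ω, (P[g | m]) ω) := by
  let ι : E →L[ℝ] WithLp 2 (E × F) :=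
    (WithLp.prodContinuousLinearEquiv 2 ℝ E F).symm.toContinuousLinearMap ∘L .inl ℝ E F
  let κ : F →L[ℝ] WithLp 2 (E × F) :=
    (WithLp.prodContinuousLinearEquiv 2 ℝ E F).symm.toContinuousLinearMap ∘L .inr ℝ E F
  have e : ∀ x y, ι x + κ y = WithLp.toLp 2 (x, y) := fun x y => by
    change WithLp.toLp 2 ((x, (0 : F)) + ((0 : E), y)) = _
    simp
  have h1 := condExp_add (ι.integrable_comp hf) (κ.integrable_comp hg) m
  have e1 : (fun ω => WithLp.toLp 2 (f ω, g ω)) = (fun ω => ι (f ω)) + fun ω => κ (g ω) :=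
    funext fun ω => (e _ _).symm
  rw [e1]
  filter_upwards [h1, ι.comp_condExp_comm hf (m := m), κ.comp_condExp_comm hg (m := m)]
    with ω h1 h2 h3
  rw [h1, ← e]
  exact congrArg₂ (· + ·) h2.symm h3.symm

theorem measurable_historySigma {Ω E F : Type*} [MeasurableSpace E]
    [MeasurableSpace F] (x : ℕ → Ω → E) (v : ℕ → Ω → F) (n : ℕ) :
    Measurable[historySigma x v n] fun ω => (WithLp.toLp 2 (x n ω, v n ω) : WithLp 2 (E × F)) := by
  have h1 : Measurable[historySigma x v n] fun ω => (x n ω, v n ω) :=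
    (comap_measurable _).mono (le_iSup₂_of_le n (Set.mem_Iic.2 le_rfl) le_rfl) le_rfl
  exact (WithLp.measurable_toLp 2 (E × F)).comp h1

/-! ### The primal-dual iteration as a forward-backward iteration. -/

section PrimalDualAlgorithm

variable {E F : Type*} [NormedAddCommGroup E] [InnerProductSpace ℝ E] [CompleteSpace E]
  [SecondCountableTopology E] [MeasurableSpace E] [BorelSpace E]
  [NormedAddCommGroup F] [InnerProductSpace ℝ F] [CompleteSpace F]
  [SecondCountableTopology F] [MeasurableSpace F] [BorelSpace F]
  {Ω : Type*} [MeasurableSpace Ω]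

/-- The inertial stochastic primal-dual iteration for the inclusions `z = L^* v + C x` and
`L x - r ∈ A v + D v`, with the resolvent written by means of the inverse `R` of `W`. -/
structure IsPrimalDualIteration (z : E) (r : F) (V : E →L[ℝ] E) (W R : F →L[ℝ] F)
    (L : E →L[ℝ] F) (A : F → Set F) (lam α : ℕ → ℝ) (a : ℕ → Ω → E) (b : ℕ → Ω → F)
    (x c p : ℕ → Ω → E) (v d q : ℕ → Ω → F) : Prop where
  primal_extrapolation : ∀ n ω, c n ω = x n ω + α n • (x n ω - x (n - 1) ω)
  dual_extrapolation : ∀ n ω, d n ω = v n ω + α n • (v n ω - v (n - 1) ω)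
  primal_step : ∀ n ω, p n ω = c n ω - V (a n ω - z) - V (L.adjoint (q n ω))
  dual_step : ∀ n ω, R (d n ω + W (L (c n ω - V (a n ω - z) - V (L.adjoint (d n ω))) - b n ω - r) -
    q n ω) ∈ A (q n ω)
  primal_update : ∀ n ω, x (n + 1) ω = x n ω + lam n • (p n ω - x n ω)
  dual_update : ∀ n ω, v (n + 1) ω = v n ω + lam n • (q n ω - v n ω)

namespace IsPrimalDualIteration

variable {z : E} {r : F} {V : E →L[ℝ] E} {W R : F →L[ℝ] F} {L : E →L[ℝ] F} {A : F → Set F}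
  {lam α : ℕ → ℝ} {a : ℕ → Ω → E} {b : ℕ → Ω → F} {x c p : ℕ → Ω → E} {v d q : ℕ → Ω → F}

/-- The iterates of the primal-dual method are measurable and square integrable. -/
theorem measurable_memLp (h : IsPrimalDualIteration z r V W R L A lam α a b x c p v d q)
    {P : Measure Ω} [IsProbabilityMeasure P] (hA : MonotoneOp A) (hR : StronglyPositive R)
    (ha : ∀ n, Measurable (a n)) (ha2 : ∀ n, MemLp (a n) 2 P)
    (hb : ∀ n, Measurable (b n)) (hb2 : ∀ n, MemLp (b n) 2 P)
    (hx0 : Measurable (x 0)) (hx02 : MemLp (x 0) 2 P)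
    (hv0 : Measurable (v 0)) (hv02 : MemLp (v 0) 2 P) (n : ℕ) :
    (Measurable (x n) ∧ MemLp (x n) 2 P ∧ Measurable (v n) ∧ MemLp (v n) 2 P) ∧
      MemLp (p n) 2 P ∧ MemLp (q n) 2 P := by
  have : Nonempty Ω := nonempty_of_isProbabilityMeasure P
  obtain ⟨k, hk⟩ := norm_resolvent_sub_le hA hR
  have step : ∀ n, (Measurable (x n) ∧ MemLp (x n) 2 P ∧ Measurable (v n) ∧ MemLp (v n) 2 P) →
      (Measurable (x (n - 1)) ∧ MemLp (x (n - 1)) 2 P ∧ Measurable (v (n - 1)) ∧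
        MemLp (v (n - 1)) 2 P) →
      Measurable (p n) ∧ MemLp (p n) 2 P ∧ Measurable (q n) ∧ MemLp (q n) 2 P := by
    rintro n ⟨h1, h2, h3, h4⟩ ⟨h1', h2', h3', h4'⟩
    have ec : c n = fun ω => x n ω + α n • (x n ω - x (n - 1) ω) :=
      funext (h.primal_extrapolation n)
    have ed : d n = fun ω => v n ω + α n • (v n ω - v (n - 1) ω) :=
      funext (h.dual_extrapolation n)
    have hcm : Measurable (c n) := ec ▸ h1.add ((h1.sub h1').const_smul _)
    have hdm : Measurable (d n) := ed ▸ h3.add ((h3.sub h3').const_smul _)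
    have hc2 : MemLp (c n) 2 P := ec ▸ h2.add ((h2.sub h2').const_smul _)
    have hd2 : MemLp (d n) 2 P := ed ▸ h4.add ((h4.sub h4').const_smul _)
    have hsm : Measurable fun ω => c n ω - V (a n ω - z) :=
      hcm.sub (V.continuous.measurable.comp ((ha n).sub_const z))
    have hs2 : MemLp (fun ω => c n ω - V (a n ω - z)) 2 P :=
      hc2.sub (V.comp_memLp' ((ha2 n).sub (memLp_const z)))
    have hum : Measurable fun ω =>
        d n ω + W (L (c n ω - V (a n ω - z) - V (L.adjoint (d n ω))) - b n ω - r) :=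
      hdm.add (W.continuous.measurable.comp (((L.continuous.measurable.comp (hsm.sub
        ((V ∘L L.adjoint).continuous.measurable.comp hdm))).sub (hb n)).sub_const r))
    have hu2 : MemLp (fun ω =>
        d n ω + W (L (c n ω - V (a n ω - z) - V (L.adjoint (d n ω))) - b n ω - r)) 2 P :=
      hd2.add (W.comp_memLp' (((L.comp_memLp' (hs2.sub
        ((V ∘L L.adjoint).comp_memLp' hd2))).sub (hb2 n)).sub (memLp_const r)))
    -- The point q is known only through an inclusion for each ω; its Lipschitz dependence on the
    -- resolvent's argument transfers measurability and square integrability.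
    have hlip := fun ω ω' => hk _ _ _ _ (h.dual_step n ω) (h.dual_step n ω')
    have hqm : Measurable (q n) := measurable_of_norm_sub_le hlip hum
    have hq2 : MemLp (q n) 2 P := memLp_of_norm_sub_le hlip hqm.aestronglyMeasurable hu2
    have ep : p n = fun ω => c n ω - V (a n ω - z) - V (L.adjoint (q n ω)) :=
      funext (h.primal_step n)
    exact ⟨ep ▸ hsm.sub ((V ∘L L.adjoint).continuous.measurable.comp hqm),
      ep ▸ hs2.sub ((V ∘L L.adjoint).comp_memLp' hq2), hqm, hq2⟩
  -- Extrapolation looks one step back, so the induction carries two consecutive indices; at n = 0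
  -- they coincide.
  have main : ∀ n, (Measurable (x n) ∧ MemLp (x n) 2 P ∧ Measurable (v n) ∧ MemLp (v n) 2 P) ∧
      (Measurable (x (n - 1)) ∧ MemLp (x (n - 1)) 2 P ∧ Measurable (v (n - 1)) ∧
        MemLp (v (n - 1)) 2 P) := by
    intro n
    induction n with
    | zero => exact ⟨⟨hx0, hx02, hv0, hv02⟩, hx0, hx02, hv0, hv02⟩
    | succ n ih =>
      refine ⟨?_, ih.1⟩
      obtain ⟨h1, h2, h3, h4⟩ := ih.1
      obtain ⟨hpm, hp2, hqm, hq2⟩ := step n ih.1 ih.2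
      have ex : x (n + 1) = fun ω => x n ω + lam n • (p n ω - x n ω) := funext (h.primal_update n)
      have ev : v (n + 1) = fun ω => v n ω + lam n • (q n ω - v n ω) := funext (h.dual_update n)
      exact ⟨ex ▸ h1.add ((hpm.sub h1).const_smul _), ex ▸ h2.add ((hp2.sub h2).const_smul _),
        ev ▸ h3.add ((hqm.sub h3).const_smul _), ev ▸ h4.add ((hq2.sub h4).const_smul _)⟩
  obtain ⟨-, hp2, -, hq2⟩ := step n (main n).1 (main n).2
  exact ⟨(main n).1, hp2, hq2⟩

omit [SecondCountableTopology E] [MeasurableSpace E] [BorelSpace E] [SecondCountableTopology F]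
  [MeasurableSpace F] [BorelSpace F] [MeasurableSpace Ω] in
/-- In the primal-dual metric, the iteration is a forward-backward iteration. -/
theorem backward_mem (h : IsPrimalDualIteration z r V W R L A lam α a b x c p v d q)
    {R' : E →L[ℝ] E} (hR' : ∀ x, R' (V x) = x) (hR : ∀ x, R (W x) = x) (n : ℕ) (ω : Ω) :
    prodOp R' (R - L ∘L V ∘L L.adjoint)
        (WithLp.toLp 2 (c n ω, d n ω) - WithLp.toLp 2 (p n ω, q n ω)) -
      WithLp.toLp 2 (a n ω, b n ω) ∈ primalDualOp z r L A (WithLp.toLp 2 (p n ω, q n ω)) := by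
  constructor
  · change R' (c n ω - p n ω) - a n ω = L.adjoint (q n ω) - z
    have e : c n ω - p n ω = V (a n ω - z + L.adjoint (q n ω)) := by
      rw [h.primal_step, map_add]
      abel
    rw [e, hR']
    abel
  · change (R - L ∘L V ∘L L.adjoint) (d n ω - q n ω) - b n ω + L (p n ω) - r ∈ A (q n ω)
    convert! h.dual_step n ω using 1
    -- The dual step uses y, built from d, instead of p, built from q. Since y - p = -V L^* (d - q),
    -- the term -L V L^* of the metric is precisely this discrepancy.
    rw [add_sub_right_comm (d n ω), map_add R, hR, h.primal_step]
    simp only [sub_apply, ContinuousLinearMap.comp_apply, map_sub]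
    abel

end IsPrimalDualIteration

/-- The natural filtration of the iterates. -/
def historyFiltration {x : ℕ → Ω → E} {v : ℕ → Ω → F} (hx : ∀ n, Measurable (x n))
    (hv : ∀ n, Measurable (v n)) : Filtration ℕ (inferInstance : MeasurableSpace Ω) where
  seq := historySigma x v
  mono' _ _ hij := biSup_mono fun _ hk => le_trans hk hij
  le' _ := iSup₂_le fun j _ => ((hx j).prodMk (hv j)).comap_le

/-- Almost sure weak convergence of the inertial stochastic primal-dual iteration, together with
the strong convergence of the forward terms. -/
theorem IsPrimalDualIteration.exists_weak_limit {z : E} {r : F} {V : E →L[ℝ] E} {W R : F →L[ℝ] F}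
    {L : E →L[ℝ] F} {A : F → Set F} {lam α : ℕ → ℝ} {a : ℕ → Ω → E} {b : ℕ → Ω → F}
    {x c p : ℕ → Ω → E} {v d q : ℕ → Ω → F}
    (h : IsPrimalDualIteration z r V W R L A lam α a b x c p v d q)
    {P : Measure Ω} [IsProbabilityMeasure P]
    (hV : IsSelfAdjoint V) (hVp : StronglyPositive V) (hW : IsSelfAdjoint W)
    (hWp : StronglyPositive W) (hRW : ∀ x, R (W x) = x) (hWR : ∀ x, W (R x) = x)
    (hA : MonotoneOp A)
    (hmax : ∀ v u, (∀ v' u', u' ∈ A v' → 0 ≤ ⟪v - v', u - u'⟫_ℝ) → u ∈ A v)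
    {ν μ β : ℝ} (hμ : 0 < μ) (hβ : 1 < 2 * β) (hβν : β ≤ ν)
    (hβμ : β ≤ μ * (1 - ‖opSqrt W ∘L L ∘L opSqrt V‖ ^ 2))
    {C : E → E} (hC : ∀ x y, ν * ⟪V (C x - C y), C x - C y⟫_ℝ ≤ ⟪x - y, C x - C y⟫_ℝ)
    {D : F → F} (hD : ∀ x y, μ * ⟪W (D x - D y), D x - D y⟫_ℝ ≤ ⟪x - y, D x - D y⟫_ℝ)
    (hzer : ∃ x v, -WithLp.toLp 2 (C x, D v) ∈ primalDualOp z r L A (WithLp.toLp 2 (x, v)))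
    {ε : ℝ} (hε : 0 < ε) (hlam : ∀ n, lam n ∈ Set.Icc ε 1) (hα : ∀ n, α n ∈ Set.Icc 0 1)
    (hαs : Summable α)
    (ha : ∀ n, Measurable (a n)) (ha2 : ∀ n, MemLp (a n) 2 P)
    (hb : ∀ n, Measurable (b n)) (hb2 : ∀ n, MemLp (b n) 2 P)
    (hx0 : Measurable (x 0)) (hx02 : MemLp (x 0) 2 P)
    (hv0 : Measurable (v 0)) (hv02 : MemLp (v 0) 2 P)
    (hmeana : ∀ n, P[a n | historySigma x v n] =ᵐ[P] fun ω => C (c n ω))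
    (hmeanb : ∀ n, P[b n | historySigma x v n] =ᵐ[P] fun ω => D (d n ω))
    (hvar : ∀ᵐ ω ∂P, Summable fun n =>
      (P[fun ω' => ‖a n ω' - C (c n ω')‖ ^ 2 + ‖b n ω' - D (d n ω')‖ ^ 2 | historySigma x v n]) ω)
    (hbdd : ∀ᵐ ω ∂P, BddAbove (Set.range fun n => ‖x n ω - x (n - 1) ω‖) ∧
      BddAbove (Set.range fun n => ‖v n ω - v (n - 1) ω‖)) :
    ∃ (xbar : Ω → E) (vbar : Ω → F), Measurable xbar ∧ Measurable vbar ∧ ∀ᵐ ω ∂P,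
      -WithLp.toLp 2 (C (xbar ω), D (vbar ω)) ∈
        primalDualOp z r L A (WithLp.toLp 2 (xbar ω, vbar ω)) ∧
      WeaklyTendsto (fun n => x n ω) (xbar ω) ∧ WeaklyTendsto (fun n => v n ω) (vbar ω) ∧
      Tendsto (fun n => c n ω - x n ω) atTop (𝓝 0) ∧
      Tendsto (fun n => d n ω - v n ω) atTop (𝓝 0) ∧
      Tendsto (fun n => C (c n ω)) atTop (𝓝 (C (xbar ω))) ∧
      Tendsto (fun n => D (d n ω)) atTop (𝓝 (D (vbar ω))) := by
  have hβ0 : 0 < β := by linarith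
  have hκ : 0 < 1 - ‖opSqrt W ∘L L ∘L opSqrt V‖ ^ 2 :=
    pos_of_mul_pos_right (hβ0.trans_le hβμ) hμ.le
  obtain ⟨R', hVR', hR'V⟩ := exists_rightInverse_leftInverse_of_isUnit hVp.isUnit
  have hmem := h.measurable_memLp hA (hWp.of_rightInverse hWR) ha ha2 hb hb2 hx0 hx02 hv0 hv02
  have toLp_memLp : ∀ {f : Ω → E} {g : Ω → F}, MemLp f 2 P → MemLp g 2 P →
      MemLp (fun ω => WithLp.toLp 2 (f ω, g ω)) 2 P := fun {f g} hf hg =>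
    (WithLp.prodContinuousLinearEquiv 2 ℝ E F).symm.toContinuousLinearMap.comp_memLp'
      (memLp_prod_iff.2 ⟨hf, hg⟩)
  have hrun : IsStochasticForwardBackward P
      (historyFiltration (fun n => (hmem n).1.1) (fun n => (hmem n).1.2.2.1))
      (prodOp R' (R - L ∘L V ∘L L.adjoint)) (primalDualOp z r L A)
      (fun t => WithLp.toLp 2 (C t.fst, D t.snd)) β ε lam α
      (fun n ω => WithLp.toLp 2 (a n ω, b n ω)) (fun n ω => WithLp.toLp 2 (x n ω, v n ω))
      (fun n ω => WithLp.toLp 2 (c n ω, d n ω)) (fun n ω => WithLp.toLp 2 (p n ω, q n ω)) :=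
    { isSelfAdjoint := (isSelfAdjoint_of_rightInverse hV hVR').prodOp
        (isSelfAdjoint_schur hV (isSelfAdjoint_of_rightInverse hW hWR))
      stronglyPositive := (hVp.of_rightInverse hVR').prodOp
        (stronglyPositive_schur hV hVp hW hWp hWR hκ)
      monotone := monotoneOp_primalDualOp hA
      one_lt := hβ
      cocoercive := primalDual_cocoercive hV hVp hVR' hW hWp hWR hμ hβ0 hβν hβμ hC hD
      eps_pos := hε
      lam_mem := hlam
      alpha_mem := hα
      summable_alpha := hαs
      memLp_approx := fun n => toLp_memLp (ha2 n) (hb2 n)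
      adapted := fun n => measurable_historySigma x v n
      memLp_iterate := fun n => toLp_memLp (hmem n).1.2.1 (hmem n).1.2.2.2
      memLp_backward := fun n => toLp_memLp (hmem n).2.1 (hmem n).2.2
      extrapolation := fun n ω => by
        rw [h.primal_extrapolation, h.dual_extrapolation]
        rfl
      backward := h.backward_mem hR'V hRW
      update := fun n ω => by
        rw [h.primal_update, h.dual_update]
        rfl
      condExp_approx := fun n => by
        filter_upwards [condExp_toLp (m := historySigma x v n) ((ha2 n).integrable one_le_two)
          ((hb2 n).integrable one_le_two), hmeana n, hmeanb n] with ω h1 h2 h3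
        rw [h2, h3] at h1
        exact h1
      summable_variance := by
        filter_upwards [hvar] with ω hω
        refine hω.congr fun n => ?_
        have e : (fun ω' => ‖a n ω' - C (c n ω')‖ ^ 2 + ‖b n ω' - D (d n ω')‖ ^ 2) = fun ω' =>
            ‖WithLp.toLp 2 (a n ω', b n ω') - WithLp.toLp 2 (C (c n ω'), D (d n ω'))‖ ^ 2 :=
          funext fun ω' => by
            rw [WithLp.prod_norm_sq_eq_of_L2]
            rfl
        rw [e]
        rfl
      bddAbove_increment := by
        filter_upwards [hbdd] with ω ⟨⟨M, hM⟩, ⟨N, hN⟩⟩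
        refine ⟨√(M ^ 2 + N ^ 2), ?_⟩
        rintro _ ⟨n, rfl⟩
        refine Real.le_sqrt_of_sq_le ?_
        rw [WithLp.prod_norm_sq_eq_of_L2]
        exact add_le_add (pow_le_pow_left₀ (norm_nonneg _) (hM ⟨n, rfl⟩) 2)
          (pow_le_pow_left₀ (norm_nonneg _) (hN ⟨n, rfl⟩) 2) }
  obtain ⟨x₀, v₀, h₀⟩ := hzer
  obtain ⟨Xbar, hXm, hX⟩ := hrun.exists_weak_limit (mem_primalDualOp_of_tendsto hA hmax) ⟨_, h₀⟩
  refine ⟨fun ω => (Xbar ω).fst, fun ω => (Xbar ω).snd,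
    (WithLp.fstL 2 ℝ E F).continuous.measurable.comp hXm,
    (WithLp.sndL 2 ℝ E F).continuous.measurable.comp hXm, ?_⟩
  filter_upwards [hX] with ω ⟨h1, h2, h3, h4⟩
  have hfst : ∀ {u : ℕ → WithLp 2 (E × F)} {l}, Tendsto u atTop (𝓝 l) →
      Tendsto (fun n => (u n).fst) atTop (𝓝 l.fst) := fun {u l} hu =>
    ((WithLp.fstL 2 ℝ E F).continuous.tendsto l).comp hu
  have hsnd : ∀ {u : ℕ → WithLp 2 (E × F)} {l}, Tendsto u atTop (𝓝 l) →
      Tendsto (fun n => (u n).snd) atTop (𝓝 l.snd) := fun {u l} hu =>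
    ((WithLp.sndL 2 ℝ E F).continuous.tendsto l).comp hu
  exact ⟨h1, h2.fst, h2.snd, hfst h3, hsnd h3, hfst h4, hsnd h4⟩

end PrimalDualAlgorithm

/-! ### The coordinatewise theorem. -/

theorem theorem4p8 {m s : ℕ} (hm : 0 < m) (hs : 0 < s)
    -- the real separable Hilbert spaces
    {K : Fin m → Type*} [∀ i, NormedAddCommGroup (K i)] [∀ i, InnerProductSpace ℝ (K i)]
    [∀ i, CompleteSpace (K i)] [∀ i, SecondCountableTopology (K i)]
    [∀ i, MeasurableSpace (K i)] [∀ i, BorelSpace (K i)]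
    {G : Fin s → Type*} [∀ k, NormedAddCommGroup (G k)] [∀ k, InnerProductSpace ℝ (G k)]
    [∀ k, CompleteSpace (G k)] [∀ k, SecondCountableTopology (G k)]
    [∀ k, MeasurableSpace (G k)] [∀ k, BorelSpace (G k)]
    -- the probability space
    {Ω : Type*} [MeasurableSpace Ω] (P : Measure Ω) [IsProbabilityMeasure P]
    -- the data of the primal-dual problem; `C x i` is `C_i x` and `Dinv k` is `D_k⁻¹`
    (ν₀ μ₀ : ℝ) (hν₀ : 0 < ν₀) (hμ₀ : 0 < μ₀)
    (z : ∀ i, K i) (V : ∀ i, K i →L[ℝ] K i)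
    (hVsa : ∀ i, IsSelfAdjoint (V i)) (hVpos : ∀ i, StronglyPositive (V i))
    (C : PiLp 2 K → PiLp 2 K)
    (hC : ∀ x y : PiLp 2 K,
      ν₀ * ∑ i, ⟪V i (C x i - C y i), C x i - C y i⟫_ℝ ≤ ∑ i, ⟪x i - y i, C x i - C y i⟫_ℝ)
    (r : ∀ k, G k) (W : ∀ k, G k →L[ℝ] G k)
    (hWsa : ∀ k, IsSelfAdjoint (W k)) (hWpos : ∀ k, StronglyPositive (W k))
    (B : ∀ k, G k → Set (G k)) (hB : ∀ k, MaximallyMonotone (B k))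
    (D : ∀ k, G k → Set (G k)) (hD : ∀ k, MaximallyMonotone (D k))
    (Dinv : ∀ k, G k → G k) (hDinv : ∀ k, inverseOp (D k) = singleValued (Dinv k))
    (hDcoco : ∀ v w : PiLp 2 G,
      μ₀ * ∑ k, ⟪W k (Dinv k (v k) - Dinv k (w k)), Dinv k (v k) - Dinv k (w k)⟫_ℝ ≤
        ∑ k, ⟪v k - w k, Dinv k (v k) - Dinv k (w k)⟫_ℝ)
    (L : ∀ k i, K i →L[ℝ] G k)
    -- the primal problem, with `A_i = 0`, has a solution
    (hprimal : (primalSolutions z (fun _ _ => {0}) C r B D L).Nonempty)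
    -- the parameters of the algorithm
    (hβ : 1 < 2 * betaConst ν₀ μ₀ V W L)
    (ε : ℝ) (hε : ε ∈ Set.Ioo 0 (min 1 (betaConst ν₀ μ₀ V W L)))
    (lam : ℕ → ℝ) (hlam : ∀ n, lam n ∈ Set.Icc ε 1)
    (α : ℕ → ℝ) (hα : ∀ n, α n ∈ Set.Icc 0 (1 - ε))
    -- the square integrable random processes and initial points
    (a : ℕ → Ω → PiLp 2 K) (ha : ∀ n, Measurable (a n)) (ha2 : ∀ n, MemLp (a n) 2 P)
    (b : ℕ → Ω → PiLp 2 G) (hb : ∀ n, Measurable (b n)) (hb2 : ∀ n, MemLp (b n) 2 P)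
    (x : ℕ → Ω → PiLp 2 K) (hx0 : Measurable (x 0)) (hx02 : MemLp (x 0) 2 P)
    (v : ℕ → Ω → PiLp 2 G) (hv0 : Measurable (v 0)) (hv02 : MemLp (v 0) 2 P)
    -- the iteration; since `0 - 1 = 0` in `ℕ`, `x (n - 1)` for `n = 0` is `x_{-1} = x_0`
    (c sv y p : ℕ → Ω → PiLp 2 K) (d q : ℕ → Ω → PiLp 2 G)
    (hc : ∀ n ω i, c n ω i = x n ω i + α n • (x n ω i - x (n - 1) ω i))
    (hd : ∀ n ω k, d n ω k = v n ω k + α n • (v n ω k - v (n - 1) ω k))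
    (hsv : ∀ n ω i, sv n ω i = c n ω i - V i (a n ω i - z i))
    (hy : ∀ n ω i, y n ω i = sv n ω i - V i (∑ k, (L k i).adjoint (d n ω k)))
    (hq : ∀ n ω k, q n ω k ∈ resolventOp (compOp (W k) (inverseOp (B k)))
      (d n ω k + W k ((∑ i, L k i (y n ω i)) - b n ω k - r k)))
    (hv : ∀ n ω k, v (n + 1) ω k = v n ω k + lam n • (q n ω k - v n ω k))
    (hp : ∀ n ω i, p n ω i = sv n ω i - V i (∑ k, (L k i).adjoint (q n ω k)))
    (hx : ∀ n ω i, x (n + 1) ω i = x n ω i + lam n • (p n ω i - x n ω i))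
    -- the stochastic conditions
    (hmeana : ∀ n, P[a n | historySigma x v n] =ᵐ[P] fun ω => C (c n ω))
    (hmeanb : ∀ n, P[b n | historySigma x v n] =ᵐ[P]
      fun ω => WithLp.toLp 2 fun k => Dinv k (d n ω k))
    (hvar : ∀ᵐ ω ∂P, Summable fun n =>
      (P[fun ω' => (∑ i, ‖a n ω' i - C (c n ω') i‖ ^ 2) +
        ∑ k, ‖b n ω' k - Dinv k (d n ω' k)‖ ^ 2 | historySigma x v n]) ω)
    (hbddx : ∀ᵐ ω ∂P, ∀ i, BddAbove (Set.range fun n => ‖x n ω i - x (n - 1) ω i‖))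
    (hbddv : ∀ᵐ ω ∂P, ∀ k, BddAbove (Set.range fun n => ‖v n ω k - v (n - 1) ω k‖))
    (hαsum : Summable α) :
    ∃ (xbar : Ω → PiLp 2 K) (vbar : Ω → PiLp 2 G), Measurable xbar ∧ Measurable vbar ∧
      (∀ᵐ ω ∂P, xbar ω ∈ primalSolutions z (fun _ _ => {0}) C r B D L ∧
        vbar ω ∈ dualSolutions z (fun _ _ => {0}) C r B D L) ∧
      -- weak convergence
      (∀ᵐ ω ∂P, (∀ i, WeaklyTendsto (fun n => x n ω i) (xbar ω i)) ∧
        ∀ k, WeaklyTendsto (fun n => v n ω k) (vbar ω k)) ∧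
      -- strong convergence of `x_n` when `C` is demiregular at the limit
      (∀ᵐ ω ∂P, DemiregularAt (singleValued C) (xbar ω) →
        ∀ i, Tendsto (fun n => x n ω i) atTop (𝓝 (xbar ω i))) ∧
      -- strong convergence of `v_{j,n}` when `D_j⁻¹` is demiregular at the limit
      (∀ j, ∀ᵐ ω ∂P, DemiregularAt (inverseOp (D j)) (vbar ω j) →
        Tendsto (fun n => v n ω j) atTop (𝓝 (vbar ω j))) ∧
      -- strong convergence of `x_{j,n}` when `C_j` depends on `x_j` only, demiregularly
      (∀ (j : Fin m) (Cj : K j → K j), (∀ u : PiLp 2 K, C u j = Cj (u j)) →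
        ∀ᵐ ω ∂P, DemiregularAt (singleValued Cj) (xbar ω j) →
          Tendsto (fun n => x n ω j) atTop (𝓝 (xbar ω j))) := by
  have hWdp := StronglyPositive.diagOp hWpos
  obtain ⟨R, hWR, hRW⟩ := exists_rightInverse_leftInverse_of_isUnit hWdp.isUnit
  have hc' : ∀ n ω, c n ω = x n ω + α n • (x n ω - x (n - 1) ω) := fun n ω =>
    PiLp.ext fun i => hc n ω i
  have hd' : ∀ n ω, d n ω = v n ω + α n • (v n ω - v (n - 1) ω) := fun n ω =>
    PiLp.ext fun k => hd n ω k
  have hsv' : ∀ n ω, sv n ω = c n ω - diagOp V (a n ω - WithLp.toLp 2 z) := fun n ω =>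
    PiLp.ext fun i => hsv n ω i
  have hy' : ∀ n ω, y n ω = sv n ω - diagOp V ((blockOp L).adjoint (d n ω)) := fun n ω =>
    PiLp.ext fun i => by
      rw [hy, PiLp.sub_apply, diagOp_apply, adjoint_blockOp_apply]
  have hp' : ∀ n ω, p n ω = sv n ω - diagOp V ((blockOp L).adjoint (q n ω)) := fun n ω =>
    PiLp.ext fun i => by
      rw [hp, PiLp.sub_apply, diagOp_apply, adjoint_blockOp_apply]
  have hq' : ∀ n ω, R (d n ω + diagOp W (blockOp L (y n ω) - b n ω - WithLp.toLp 2 r) - q n ω) ∈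
      prodInverseOp B (q n ω) := by
    refine fun n ω => mem_prodInverseOp_of_resolventOp hRW fun k => ?_
    have e : (d n ω + diagOp W (blockOp L (y n ω) - b n ω - WithLp.toLp 2 r)) k =
        d n ω k + W k ((∑ i, L k i (y n ω i)) - b n ω k - r k) := by
      rw [PiLp.add_apply, diagOp_apply, PiLp.sub_apply, PiLp.sub_apply, blockOp_apply]
    rw [e]
    exact hq n ω k
  have hrun : IsPrimalDualIteration (WithLp.toLp 2 z) (WithLp.toLp 2 r) (diagOp V) (diagOp W) R
      (blockOp L) (prodInverseOp B) lam α a b x c p v d q :=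
    { primal_extrapolation := hc'
      dual_extrapolation := hd'
      primal_step := fun n ω => by rw [hp', hsv']
      dual_step := fun n ω => by
        have := hq' n ω
        rwa [hy', hsv'] at this
      primal_update := fun n ω => PiLp.ext fun i => hx n ω i
      dual_update := fun n ω => PiLp.ext fun k => hv n ω k }
  have hzer : ∃ x v, -WithLp.toLp 2 (C x, WithLp.toLp 2 fun k => Dinv k (v k)) ∈
      primalDualOp (WithLp.toLp 2 z) (WithLp.toLp 2 r) (blockOp L) (prodInverseOp B)
        (WithLp.toLp 2 (x, v)) := by
    obtain ⟨x₀, h₀⟩ := hprimal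
    exact ⟨x₀, (mem_primalSolutions_iff (z := WithLp.toLp 2 z) (r := WithLp.toLp 2 r)
      hDinv).1 h₀⟩
  obtain ⟨xbar, vbar, hxm, hvm, hlim⟩ := hrun.exists_weak_limit (P := P) (.diagOp hVsa)
    (.diagOp hVpos) (.diagOp hWsa) hWdp hRW hWR (monotoneOp_prodInverseOp fun k => (hB k).1)
    (mem_prodInverseOp_of_forall hB) hμ₀ hβ (min_le_left _ _) (min_le_right _ _) (C := C)
    (fun x y => by simpa only [PiLp.inner_apply] using! hC x y)
    (D := fun v => WithLp.toLp 2 fun k => Dinv k (v k))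
    (fun v w => by simpa only [PiLp.inner_apply] using! hDcoco v w) hzer hε.1 hlam
    (fun n => ⟨(hα n).1, (hα n).2.trans (by linarith [hε.1])⟩) hαsum ha ha2 hb hb2 hx0 hx02 hv0
    hv02 hmeana hmeanb
    (by
      filter_upwards [hvar] with ω hω
      simpa only [PiLp.norm_sq_eq_of_L2] using! hω)
    (by
      filter_upwards [hbddx, hbddv] with ω h1 h2
      exact ⟨PiLp.bddAbove_range_norm (fun n => x n ω - x (n - 1) ω) h1,
        PiLp.bddAbove_range_norm (fun n => v n ω - v (n - 1) ω) h2⟩)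
  refine ⟨xbar, vbar, hxm, hvm, ?_, ?_, ?_, fun j => ?_, fun j Cj hCj => ?_⟩
  · filter_upwards [hlim] with ω ⟨h, _⟩
    exact ⟨(mem_primalSolutions_iff (z := WithLp.toLp 2 z) (r := WithLp.toLp 2 r) hDinv).2 ⟨_, h⟩,
      (mem_dualSolutions_iff (z := WithLp.toLp 2 z) (r := WithLp.toLp 2 r) hDinv).2 ⟨_, h⟩⟩
  · filter_upwards [hlim] with ω ⟨_, hxw, hvw, _⟩
    exact ⟨hxw.apply, hvw.apply⟩
  · filter_upwards [hlim] with ω ⟨_, hxw, _, hcx, _, hCc, _⟩ hreg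
    exact PiLp.tendsto_apply (hreg.tendsto_of_weaklyTendsto hxw hcx hCc)
  · filter_upwards [hlim] with ω ⟨_, _, hvw, _, hdv, _, hDd⟩ hreg
    rw [hDinv] at hreg
    exact hreg.tendsto_of_weaklyTendsto (hvw.apply j) (PiLp.tendsto_apply hdv j)
      (PiLp.tendsto_apply hDd j)
  · filter_upwards [hlim] with ω ⟨_, hxw, _, hcx, _, hCc, _⟩ hreg
    -- Coordinate j of the strongly convergent C(c_n) is `Cj` at coordinate j of c_n, so
    -- demiregularity of `Cj` alone suffices.
    have hCcj := PiLp.tendsto_apply hCc j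
    simp only [hCj] at hCcj
    exact hreg.tendsto_of_weaklyTendsto (hxw.apply j) (PiLp.tendsto_apply hcx j) hCcj
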